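/- **Model.** A network is a finite simple connected graph $G=(V,E)$ with $n=|V|\ge 1$ nodes and $m=|E|$ edges that stays connected after the removal of any single edge (2-edge-connected). The nodes have distinct positive integers $\mathsf{ID}(v)$ as identifiers, and each node $v$ numbers its incident edges (ports) by $1,\dots,\deg(v)$ in an arbitrary way. A node initially knows only an upper bound $N\ge n$, which is the same for all nodes, its own identifier and its degree. Nodes communicate by content-free pulses. A deterministic algorithm tells a node, upon initialization and upon each arrival of a pulse (of which it sees only the port), how to update its local state and how many pulses to send on each port. All nodes are initialized at time $0$; then, at each time step, as long as pulses are in transit, an adversarial scheduler picks one of them and delivers it, and all actions it triggers are performed instantaneously. A node that has declared termination ignores all further pulses; it terminates *quiescently* if moreover no pulse arrives at it afterwards. **Algorithm.** Every node $v$ first replaces its identifier by $N\cdot\mathsf{ID}(v)$ and sends one pulse on each port. *Synchronized counting:* node $v$ keeps a counter, initially $0$. Whenever a pulse arrives on port $i$: if the number $\rho_i$ of pulses received on port $i$ is now the minimum of all $\rho_j$, then $v$ increments the counter and sends one pulse on each port, and if the counter has reached $N\cdot \mathsf{ID}(v)$, it outputs $\mathsf{Leader}$, puts $L=N\cdot\mathsf{ID}(v)$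 and starts the DFS; otherwise, if $\rho_i$ exceeds the number $\sigma_i$ of pulses sent on port $i$ by more than $1$, it outputs $\mathsf{Non\text{-}Leader}$, makes $i$ its parent port, puts $L=N\lfloor \mathsf{count}/N\rfloor$, waits until $\rho_i=L+N+2$, and joins the DFS. *DFS notification:* a node in the DFS keeps the set of ports, other than its parent port, on which it has not yet registered $L+N+2$ received pulses. It takes the smallest such port $j$, waits until $\rho_j\ge L+1$, sends pulses on port $j$ until $L+N+2$ have been sent there since the start, and waits until $\rho_j=L+N+2$; if meanwhile $\rho_h=L+N+2$ for another port $h$ of the set, it removes $h$ and replies by sending pulses on port $h$ until $L+N+2$ have been sent there. Then it goes on with the next port. When no port is left, a non-leader sends pulses on its parent port until $L+N+2$ have been sent there, and the node terminates. (In the degenerate case $n=1$ the only node declares itself leader and terminates at once.) **Theorem 1.** There is a constant $C$ such that the following holds for this deterministic algorithm in every such network, for every $N\ge n$, all identifiers and port numberings, and every choice of the scheduler. Let $r$ be the node with the smallest identifier, $\mathsf{ID_{\min}}=\mathsf{ID}(r)$. Every node terminates quiescently after finitely many steps; the final output of $r$ is $\mathsf{Leader}$, and the final output of every other node is $\mathsf{Non\text{-}Leader}$;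 the leader $r$ terminates strictly later than every other node; the total number of pulses sent is at most $C\cdot m\cdot N\cdot\mathsf{ID_{\min}}$, i.e. $O(m\cdot N\cdot \mathsf{ID_{\min}})$; and from the termination of $r$ on, exactly $N\cdot\mathsf{ID_{\min}}+N+2$ pulses in total (both phases together) have been sent, and have been delivered, along each directed edge. -/

import Mathlib

namespace ContentOblivious

/-! ### The content-oblivious asynchronous model -/

/-- The two possible outputs of a node. -/
inductive Role where
  | leader
  | nonLeader

/-- A deterministic event-driven pulse algorithm, run by every node.  A node acts only on
initialization, when it is given the size bound `N`, its identifier and its degree, and on receiving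
a pulse, when it is given the port of arrival.  Each action yields a new local state and the number
of pulses to send on each port; the ports of a node of degree `k` are `1, …, k`, and numbers attached
to other ports are void. -/
structure Algorithm where
  /-- the local states -/
  State : Type
  /-- `init N id deg` -/
  init : ℕ → ℕ → ℕ → State × (ℕ → ℕ)
  /-- `onPulse state port` -/
  onPulse : State → ℕ → State × (ℕ → ℕ)
  /-- the current output of the node (`none`: undecided) -/
  output : State → Option Role
  /-- whether the node has declared termination -/
  halted : State → Bool

/-- Distinct positive identifiers for the nodes of `G`, and port numbers: `port v u` is the number of
the port of `v` leading to its neighbour `u`. -/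
structure Labeling {V : Type*} [Fintype V] (G : SimpleGraph V) [DecidableRel G.Adj] where
  id : V → ℕ
  id_pos : ∀ v, 0 < id v
  id_injective : Function.Injective id
  port : V → V → ℕ
  port_bijOn : ∀ v, Set.BijOn (port v) (G.neighborSet v) (Set.Icc 1 (G.degree v))

/-- A configuration of the network: the local states and, for each directed edge `d`, the numbers of
pulses sent and delivered along `d` since the start. -/
structure Config {V : Type*} (A : Algorithm) (G : SimpleGraph V) where
  state : V → A.State
  sent : G.Dart → ℕ
  received : G.Dart → ℕ

namespace Config

variable {V : Type*} [Fintype V] {A : Algorithm} {G : SimpleGraph V} [DecidableRel G.Adj]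

/-- Some pulse is in transit along `d`. -/
def InTransit (c : Config A G) (d : G.Dart) : Prop := c.received d < c.sent d

/-- The configuration after the initialization of all nodes. -/
def initial (A : Algorithm) (L : Labeling G) (N : ℕ) : Config A G where
  state v := (A.init N (L.id v) (G.degree v)).1
  sent d := (A.init N (L.id d.fst) (G.degree d.fst)).2 (L.port d.fst d.snd)
  received _ := 0

/-- The delivery of one pulse along `d`, together with all actions it triggers.  A node that has
declared termination ignores the pulse. -/
def deliver [DecidableEq V] (L : Labeling G) (c : Config A G) (d : G.Dart) : Config A G :=
  let v := d.snd
  let r := A.onPulse (c.state v) (L.port v d.fst)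
  let received' := Function.update c.received d (c.received d + 1)
  if A.halted (c.state v) then { c with received := received' }
  else
    { state := Function.update c.state v r.1
      sent := fun e => if e.fst = v then c.sent e + r.2 (L.port v e.snd) else c.sent e
      received := received' }

end Config

section Executions

variable {V : Type*} [Fintype V] [DecidableEq V] {A : Algorithm} {G : SimpleGraph V}
  [DecidableRel G.Adj]

/-- `c 0, c 1, …` is an execution: as long as there are pulses in transit, an arbitrary scheduler
selects one of them and delivers it; afterwards nothing happens any more. -/
def IsExecution (L : Labeling G) (N : ℕ) (c : ℕ → Config A G) : Prop :=
  c 0 = Config.initial A L N ∧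
  ∀ t, (∃ d, (c t).InTransit d ∧ c (t + 1) = (c t).deliver L d) ∨
    ((∀ d, ¬ (c t).InTransit d) ∧ c (t + 1) = c t)

/-- In the execution `c` the node `v` declares termination at time `t`. -/
def TerminatesAt (c : ℕ → Config A G) (v : V) (t : ℕ) : Prop :=
  A.halted ((c t).state v) = true ∧ ∀ s < t, A.halted ((c s).state v) = false

/-- The node `v` terminates at time `t`, and no pulse arrives at `v` after time `t`. -/
def QuiescentlyTerminatesAt (c : ℕ → Config A G) (v : V) (t : ℕ) : Prop :=
  TerminatesAt c v t ∧
  ∀ s, t ≤ s → ∀ d : G.Dart, d.snd = v → (c s).received d = (c t).received d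

end Executions

/-! ### The algorithm: synchronized counting, then DFS notification -/

/-- What the node is currently doing. -/
inductive Stage where
  /-- the synchronized counting phase -/
  | counting
  /-- waiting for the rest of the explore-notification on the parent port -/
  | awaitExplore
  /-- about to send an explore-notification on port `j`, waiting for enough pulses on port `j` -/
  | awaitReady (j : ℕ)
  /-- explore-notification sent on port `j`, waiting for the DFS to return from port `j` -/
  | awaitDone (j : ℕ)
  /-- terminated -/
  | finished

/-- The local variables of a node. -/
structure NodeState where
  /-- the known bound `N` on the number of nodes -/
  bound : ℕ
  /-- the scaled identifier, i.e. the identifier times `N` -/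
  scaledId : ℕ
  deg : ℕ
  /-- number of pulses sent so far on each port -/
  sigma : ℕ → ℕ
  /-- number of pulses received so far on each port -/
  rho : ℕ → ℕ
  count : ℕ
  /-- `none` during synchronized counting, afterwards the output of the node -/
  role : Option Role
  /-- the scaled identifier of the leader, meaningful once `role` is set -/
  leaderId : ℕ
  /-- the parent port, meaningful for non-leaders -/
  parent : ℕ
  /-- the unexplored ports -/
  unexplored : Finset ℕ
  stage : Stage

namespace NodeState

/-- The ports of the node. -/
def ports (s : NodeState) : Finset ℕ := Finset.Icc 1 s.deg

/-- The number of pulses that make up a complete notification (counted from the start). -/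
def threshold (s : NodeState) : ℕ := s.leaderId + s.bound + 2

/-- Send one pulse on each port. -/
def sendAll (s : NodeState) : NodeState := { s with sigma := fun i => s.sigma i + 1 }

/-- Send pulses on port `i` until `threshold` pulses have been sent on it since the start. -/
def sendNotification (s : NodeState) (i : ℕ) : NodeState :=
  { s with sigma := Function.update s.sigma i (max (s.sigma i) s.threshold) }

/-- Send the explore-notification on port `j` if at least `leaderId + 1` pulses have arrived there;
otherwise wait for them. -/
def tryExplore (s : NodeState) (j : ℕ) : NodeState :=
  if s.leaderId + 1 ≤ s.rho j then { s.sendNotification j with stage := .awaitDone j }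
  else { s with stage := .awaitReady j }

/-- Terminate; a non-leader first sends the done-notification to its parent. -/
def finish (s : NodeState) : NodeState :=
  match s.role with
  | some .nonLeader => { s.sendNotification s.parent with stage := .finished }
  | _ => { s with stage := .finished }

/-- Continue the DFS on the smallest unexplored port, or finish if there is none. -/
def nextPort (s : NodeState) : NodeState :=
  if h : s.unexplored.Nonempty then s.tryExplore (s.unexplored.min' h) else s.finish

/-- Exit synchronized counting as the leader and start the DFS. -/
def becomeLeader (s : NodeState) : NodeState :=
  nextPort { s with
    role := some .leader
    leaderId := s.scaledId
    unexplored := s.ports }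

/-- If the explore-notification on the parent port is complete, continue the DFS from here. -/
def tryJoin (s : NodeState) : NodeState :=
  if s.rho s.parent = s.threshold then s.nextPort else s

/-- Exit synchronized counting as a non-leader with parent port `i`. -/
def becomeNonLeader (s : NodeState) (i : ℕ) : NodeState :=
  tryJoin { s with
    role := some .nonLeader
    leaderId := s.count / s.bound * s.bound
    parent := i
    unexplored := s.ports.erase i
    stage := .awaitExplore }

/-- Increment the counter and send one pulse on each port; become the leader when the counter
reaches the scaled identifier. -/
def increment (s : NodeState) : NodeState :=
  let s' := { s with count := s.count + 1 }.sendAll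
  if s'.count = s'.scaledId then s'.becomeLeader else s'

/-- The reaction to a pulse that has arrived on port `i` (already counted in `rho i`). -/
def react (s : NodeState) (i : ℕ) : NodeState :=
  match s.stage with
  | .counting =>
      if ∀ j ∈ s.ports, s.rho i ≤ s.rho j then s.increment
      else if s.sigma i + 1 < s.rho i then s.becomeNonLeader i
      else s
  | .awaitExplore => s.tryJoin
  | .awaitReady j => s.tryExplore j
  | .awaitDone j =>
      if i ∈ s.unexplored ∧ s.rho i = s.threshold then
        let s' := { s with unexplored := s.unexplored.erase i }
        -- either the DFS returns from port `j`, or it comes in through a back edge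
        if i = j then s'.nextPort else s'.sendNotification i
      else s
  | .finished => s

/-- Count the pulse that arrives on port `i` and react to it. -/
def receive (s : NodeState) (i : ℕ) : NodeState :=
  react { s with rho := Function.update s.rho i (s.rho i + 1) } i

/-- The state after initialization: the identifier is multiplied by `N` and one pulse is sent on each
port.  (A node without ports is alone in its network; it declares itself the leader and
terminates.) -/
def start (N id deg : ℕ) : NodeState where
  bound := N
  scaledId := id * N
  deg := deg
  sigma := fun _ => 1
  rho := fun _ => 0
  count := 0
  role := if deg = 0 then some .leader else none
  leaderId := if deg = 0 then id * N else 0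
  parent := 0
  unexplored := ∅
  stage := if deg = 0 then .finished else .counting

end NodeState

/-- Leader election by synchronized counting followed by DFS notification. -/
def election : Algorithm where
  State := NodeState
  init N id deg := (NodeState.start N id deg, (NodeState.start N id deg).sigma)
  onPulse s i := (s.receive i, fun p => (s.receive i).sigma p - s.sigma p)
  output s := s.role
  halted s := match s.stage with
    | .finished => true
    | _ => false

end ContentOblivious

/-!
Let `M = N * ID_min`.  Every directed edge ends up with `M + N + 2` pulses, a complete notification.

The proof replaces port numbers by neighbours and describes a configuration by a snapshot `Net`,
which also records two things that no node knows: the DFS stack and the parent of each node, the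
latter from the moment the parent starts to notify it.  The invariant `Inv` lists what holds of every
reachable snapshot.  A counting node keeps its counter equal to the minimum number of pulses received
and has sent one pulse more on each port; on an edge of a node on the stack, the numbers of pulses
tell whether the edge has been explored; a finished node has sent and received complete
notifications on all its edges.  Hence the classical property of DFS on undirected graphs: a
finished node has no neighbour that the DFS has not reached.

The crucial point is that all counters stay below `M + N`, so that only `r` becomes the leader, every
other node can tell a notification from the pulses of synchronized counting, and it reads off `M` as
`N * ⌊count / N⌋`.  Neighbouring counters satisfy `cnt x ≤ cnt y + 1`, except when `y` is the parent
of `x`: the parent floods that edge with its notification.  As the counter of `r` never exceeds `M`,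
the bound follows (`Escapes.lt_add_card`) if every nonempty set of nodes that avoids `r` is left by
an edge that does not lead from a node to its parent.  This property, `Escapes`, is part of the
invariant.  It survives the creation of a tree edge by 2-edge-connectivity and the shape of the DFS
stack (`Inv.escapes_update`).

When no pulse is in transit, the counters of all nodes have reached `M`, the token holder cannot be
waiting, and so all nodes are finished (`Inv.all_finished_of_quiescent`).  As at most `M + N + 2`
pulses are sent on each directed edge, this happens after finitely many steps.  The leader is last,
because the stack is empty when it finishes, and then the finished nodes are closed under adjacency.
-/

namespace ContentOblivious

/-! ### Two-edge-connected graphs and escaping arcs -/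

section Escaping

variable {V : Type*} {G : SimpleGraph V}

theorem exists_adj_ne_of_isEdgeConnected_two (hG : G.IsEdgeConnected 2) {X : Set V} {x r : V}
    (hx : x ∈ X) (hr : r ∉ X) (e : Sym2 V) :
    ∃ y ∈ X, ∃ z ∉ X, G.Adj y z ∧ s(y, z) ≠ e := by
  obtain ⟨p⟩ := hG x r (s := {e}) (by simp)
  obtain ⟨d, -, h1, h2⟩ := p.exists_boundary_dart X hx hr
  have := d.adj
  simp only [SimpleGraph.deleteEdges_adj, Set.mem_singleton_iff] at this
  exact ⟨_, h1, _, h2, this⟩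

theorem exists_adj_of_isEdgeConnected_two [Nontrivial V] (hG : G.IsEdgeConnected 2) (v : V) :
    ∃ u, G.Adj v u := by
  obtain ⟨w, hw⟩ := exists_ne v
  obtain ⟨y, hy, z, -, hyz, -⟩ := exists_adj_ne_of_isEdgeConnected_two hG
    (X := {v}) (Set.mem_singleton v) hw s(v, v)
  rw [Set.mem_singleton_iff] at hy
  exact ⟨z, hy ▸ hyz⟩

/-- Every nonempty set of nodes that avoids `r` is left by some edge `x — y` that does not lead from
`x` to its own parent.  Equivalently, `r` can be reached from everywhere without ever stepping from a
node to its parent. -/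
def Escapes (G : SimpleGraph V) (r : V) (par : V → Option V) : Prop :=
  ∀ X : Set V, r ∉ X → X.Nonempty → ∃ x ∈ X, ∃ y ∉ X, G.Adj x y ∧ par x ≠ some y

/-- A function that grows by at most one along all edges except those from a parent to a child
exceeds its value at `r` by less than the number of nodes: otherwise some intermediate value is
skipped, and the nodes above that value have no escaping edge. -/
theorem Escapes.lt_add_card [Fintype V] {r : V} {par : V → Option V} (h : Escapes G r par)
    {f : V → ℕ} {M : ℕ} (hr : f r ≤ M) (hf : ∀ x y, G.Adj x y → par x ≠ some y → f x ≤ f y + 1)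
    (v : V) : f v < M + Fintype.card V := by
  classical
  by_contra! hv
  have hlevel : ∀ l ∈ Finset.Ioc M (M + Fintype.card V), ∃ x ≠ r, f x = l := by
    intro l hl
    rw [Finset.mem_Ioc] at hl
    obtain ⟨x, hx, y, hy, hxy, hp⟩ := h {x | l ≤ f x}
      (by simp only [Set.mem_ofPred_eq]; omega) ⟨v, by simp only [Set.mem_ofPred_eq]; omega⟩
    have := hf x y hxy hp
    simp only [Set.mem_ofPred_eq] at hx hy
    exact ⟨x, fun hxr => by subst hxr; omega, by omega⟩
  have hsub : Finset.Ioc M (M + Fintype.card V) ⊆ (Finset.univ.erase r).image f := by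
    intro l hl
    obtain ⟨x, hx, rfl⟩ := hlevel l hl
    exact Finset.mem_image_of_mem _ (by simp [hx])
  have h1 := Finset.card_le_card hsub
  have h2 := Finset.card_image_le (s := Finset.univ.erase r) (f := f)
  rw [Finset.card_erase_of_mem (Finset.mem_univ r), Finset.card_univ] at h2
  rw [Nat.card_Ioc] at h1
  have : 0 < Fintype.card V := Fintype.card_pos_iff.2 ⟨r⟩
  omega

end Escaping

/-! ### Network snapshots -/

/-- What a node is currently doing, with neighbours in place of port numbers.  The phase `hold`
exists only within an action: the node holds the DFS token and is about to choose its next port. -/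
inductive Phase (V : Type*) where
  | counting
  | awaitExplore
  | hold
  /-- about to explore the edge to `j`, but waiting for more pulses from there -/
  | ready (j : V)
  /-- the edge to `j` is being explored -/
  | done (j : V)
  | finished

/-- A snapshot of the network, indexed by nodes instead of ports, with two pieces of bookkeeping that
no node knows: the parent relation and the DFS stack. -/
structure Net (V : Type*) where
  phase : V → Phase V
  cnt : V → ℕ
  /-- `snt u v` is the number of pulses sent from `u` to `v` -/
  snt : V → V → ℕ
  /-- `rcv u v` is the number of pulses delivered from `u` to `v` -/
  rcv : V → V → ℕ
  /-- The parent of `v` in the DFS tree.  It is set as soon as the parent sends the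
  explore-notification, while `v` may still be counting. -/
  par : V → Option V
  /-- The nodes on the DFS path from the root to the token, the holder of the token first. -/
  stack : List V

namespace Net

variable {V : Type*}

/-- The node has not been reached by the DFS yet; it may be waiting for the rest of an
explore-notification. -/
def Fresh (g : Net V) (v : V) : Prop := g.phase v = .counting ∨ g.phase v = .awaitExplore

/-- The list is a path of parents that ends in `r`, and each node other than the first one waits for
the DFS to return from the preceding one. -/
def Chain (g : Net V) (r : V) : List V → Prop
  | [] => True
  | [a] => a = r
  | a :: b :: l => g.par a = some b ∧ g.phase b = .done a ∧ Chain g r (b :: l)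

theorem Chain.congr {g g' : Net V} {r : V} {l : List V} (h : g.Chain r l)
    (hphase : ∀ v ∈ l.tail, g'.phase v = g.phase v) (hpar : ∀ v ∈ l, g'.par v = g.par v) :
    g'.Chain r l := by
  induction l with
  | nil => trivial
  | cons a l ih =>
    cases l with
    | nil => exact h
    | cons b l =>
      obtain ⟨h1, h2, h3⟩ := h
      refine ⟨(hpar a (by simp)).trans h1, (hphase b (by simp)).trans h2, ih h3 ?_ ?_⟩
      · intro v hv
        exact hphase v (by simp only [List.tail_cons] at hv ⊢; simp [hv])
      · intro v hv
        exact hpar v (by simp [hv])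

theorem Chain.above {g : Net V} {r s x : V} {l : List V} (h : g.Chain r (s :: l)) (hx : x ∈ l) :
    ∃ a ∈ s :: l, g.phase x = .done a ∧ g.par a = some x := by
  induction l generalizing s with
  | nil => simp at hx
  | cons b l ih =>
    obtain ⟨h1, h2, h3⟩ := h
    rcases List.mem_cons.1 hx with rfl | hx
    · exact ⟨s, by simp, h2, h1⟩
    · obtain ⟨a, ha, h⟩ := ih h3 hx
      exact ⟨a, List.mem_cons_of_mem _ ha, h⟩

theorem Chain.par_mem {g : Net V} {r x p : V} {l : List V} (h : g.Chain r l) (hx : x ∈ l)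
    (hr : g.par r = none) (hp : g.par x = some p) : p ∈ l.tail := by
  induction l with
  | nil => simp at hx
  | cons a l ih =>
    cases l with
    | nil =>
      obtain rfl : x = a := by simpa using hx
      obtain rfl : x = r := h
      simp [hr] at hp
    | cons b l =>
      obtain ⟨h1, h2, h3⟩ := h
      rcases List.mem_cons.1 hx with rfl | hx
      · obtain rfl : b = p := by simpa [h1] using hp
        simp
      · exact List.mem_cons_of_mem _ (by simpa using ih h3 hx)

theorem Chain.root_mem {g : Net V} {r s : V} {l : List V} (h : g.Chain r (s :: l)) :
    r ∈ s :: l := by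
  induction l generalizing s with
  | nil => exact List.mem_singleton.2 h.symm
  | cons b l ih => exact List.mem_cons_of_mem _ (ih h.2.2)

/-- If a set contains some node of the stack but not the top one, then the stack leaves the set
somewhere on the way up. -/
theorem Chain.exists_boundary {g : Net V} {r s x : V} {l : List V} {X : Set V}
    (h : g.Chain r (s :: l)) (hs : s ∉ X) (hx : x ∈ l) (hxX : x ∈ X) :
    ∃ a ∉ X, ∃ b ∈ X, b ∈ l ∧ g.phase b = .done a := by
  induction l generalizing s with
  | nil => simp at hx
  | cons b l ih =>
    obtain ⟨h1, h2, h3⟩ := h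
    by_cases hb : b ∈ X
    · exact ⟨s, hs, b, hb, by simp, h2⟩
    · have hx' : x ∈ l := by
        rcases List.mem_cons.1 hx with rfl | hx
        · exact absurd hxX hb
        · exact hx
      obtain ⟨a, ha, c, hc, hcl, hca⟩ := ih h3 hb hx'
      exact ⟨a, ha, c, hc, List.mem_cons_of_mem _ hcl, hca⟩

end Net

/-! ### The invariant -/

/-- The invariant of the algorithm on a network snapshot, where `M` is the scaled identifier of the
node `r` with the smallest identifier.  A complete notification brings the number of pulses on a
directed edge to `M + N + 2`. -/
structure Inv {V : Type*} (G : SimpleGraph V) (r : V) (M N : ℕ) (g : Net V) : Prop where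
  rcv_le : ∀ u v, G.Adj u v → g.rcv u v ≤ g.snt u v
  fresh_snt : ∀ v u, G.Adj v u → g.Fresh v → g.snt v u = g.cnt v + 1
  fresh_rcv : ∀ v u, G.Adj v u → g.Fresh v → g.rcv u v < M + N + 2
  counting_le : ∀ v u, G.Adj v u → g.phase v = .counting → g.cnt v ≤ g.rcv u v
  counting_ex : ∀ v, g.phase v = .counting → ∃ u, G.Adj v u ∧ g.rcv u v ≤ g.cnt v
  cnt_root : g.cnt r ≤ M
  le_cnt : ∀ v, g.phase v ≠ .counting → M ≤ g.cnt v
  mem_stack : ∀ v, v ∈ g.stack ↔ ¬ g.Fresh v ∧ g.phase v ≠ .finished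
  /-- the parent has been heard completely, and gets its reply only at the end -/
  active_par : ∀ v u, v ∈ g.stack → g.par v = some u →
    g.rcv u v = M + N + 2 ∧ g.snt v u = g.cnt v + 1
  active_unexplored : ∀ v u, G.Adj v u → v ∈ g.stack → g.par v ≠ some u →
    g.rcv u v ≠ M + N + 2 → g.phase v ≠ .done u → g.snt v u = g.cnt v + 1
  active_explored : ∀ v u, G.Adj v u → v ∈ g.stack → g.par v ≠ some u →
    g.rcv u v = M + N + 2 → g.snt v u = M + N + 2
  ready : ∀ v j, g.phase v = .ready j → G.Adj v j ∧ g.par v ≠ some j ∧ g.rcv j v ≤ M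
  done : ∀ v j, g.phase v = .done j → G.Adj v j ∧ g.par v ≠ some j ∧ M + 1 ≤ g.rcv j v ∧
    g.rcv j v < M + N + 2 ∧ g.snt v j = M + N + 2
  finished : ∀ v u, G.Adj v u → g.phase v = .finished →
    g.rcv u v = M + N + 2 ∧ g.snt v u = M + N + 2
  chain : g.Chain r g.stack
  nodup : g.stack.Nodup
  /-- a fresh node with a parent is being explored from the top of the stack -/
  pending : ∀ x s, g.Fresh x → g.par x = some s → g.stack.head? = some s ∧ g.phase s = .done x
  par_of_done : ∀ s x, g.phase s = .done x → g.Fresh x → g.par x = some s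
  par_adj : ∀ x y, g.par x = some y → G.Adj x y ∧ ¬ g.Fresh y
  par_root : g.par r = none
  par_ne_none : ∀ v, v ≠ r → g.phase v ≠ .counting → g.par v ≠ none
  root_ne_awaitExplore : g.phase r ≠ .awaitExplore
  root_counting : g.phase r = .counting → ∀ v, g.phase v = .counting
  escapes : Escapes G r g.par
  /-- Counters of neighbours differ by at most one as long as both count.  A node whose counter is frozen
  can only be overtaken, and only a parent sends pulses other than those of synchronized counting to
  a node that counts. -/
  cnt_le : ∀ x y, G.Adj x y → g.par x ≠ some y → g.cnt x ≤ g.cnt y + 1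

section Snapshots

variable {V : Type*} {G : SimpleGraph V} {r : V} {M N : ℕ} {g : Net V}

/-! ### Consequences of the invariant -/

namespace Inv

/-- No counter reaches the scaled identifier of a node other than `r`. -/
theorem cnt_lt [Fintype V] (h : Inv G r M N g) (hN : Fintype.card V ≤ N) (v : V) :
    g.cnt v < M + N :=
  (h.escapes.lt_add_card h.cnt_root h.cnt_le v).trans_le (by omega)

theorem snt_le [Fintype V] (h : Inv G r M N g) (hN : Fintype.card V ≤ N) {v u : V}
    (huv : G.Adj v u) : g.snt v u ≤ M + N + 2 := by
  have := h.cnt_lt hN v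
  by_cases hf : g.Fresh v
  · have := h.fresh_snt v u huv hf
    omega
  by_cases hp : g.phase v = .finished
  · exact (h.finished v u huv hp).2.le
  have hv := (h.mem_stack v).2 ⟨hf, hp⟩
  by_cases hpar : g.par v = some u
  · have := (h.active_par v u hv hpar).2
    omega
  by_cases hr : g.rcv u v = M + N + 2
  · exact (h.active_explored v u huv hv hpar hr).le
  by_cases hd : g.phase v = .done u
  · exact (h.done v u hd).2.2.2.2.le
  · have := h.active_unexplored v u huv hv hpar hr hd
    omega

/-- A node that holds the token, or waits to pass it on, is at the top of the stack, since the other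
nodes of the stack wait for the DFS to return. -/
theorem stack_eq_cons (h : Inv G r M N g) {x : V}
    (hx : g.phase x = .hold ∨ ∃ j, g.phase x = .ready j) : ∃ l, g.stack = x :: l := by
  have hmem : x ∈ g.stack := (h.mem_stack x).2 (by
    rcases hx with hx | ⟨j, hx⟩ <;> simp [Net.Fresh, hx])
  cases hs : g.stack with
  | nil => simp [hs] at hmem
  | cons s l =>
    rw [hs] at hmem
    rcases List.mem_cons.1 hmem with rfl | hmem
    · exact ⟨l, rfl⟩
    · have hc := h.chain
      rw [hs] at hc
      obtain ⟨a, -, ha, -⟩ := hc.above hmem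
      rcases hx with hx | ⟨j, hx⟩ <;> simp [hx] at ha

/-- The pulses that have been sent to a fresh node other than by its parent are those of synchronized
counting. -/
theorem snt_eq_of_fresh [Fintype V] (h : Inv G r M N g) (hN : Fintype.card V ≤ N) {u x : V}
    (hux : G.Adj x u) (hxf : g.Fresh x) (hp : g.par x ≠ some u) :
    g.snt u x = g.cnt u + 1 := by
  have h1 := h.rcv_le x u hux
  have h2 := h.fresh_snt x u hux hxf
  have h3 := h.cnt_lt hN x
  by_cases hf : g.Fresh u
  · exact h.fresh_snt u x hux.symm hf
  by_cases hfin : g.phase u = .finished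
  · have := (h.finished u x hux.symm hfin).1
    omega
  refine h.active_unexplored u x hux.symm ((h.mem_stack u).2 ⟨hf, hfin⟩)
    (fun hpu => (h.par_adj u x hpu).2 hxf) (by omega) fun hd => hp (h.par_of_done u x hd hxf)

/-- Only an explore-notification can put a neighbour two rounds ahead of a counting node. -/
theorem par_of_lt_snt [Fintype V] (h : Inv G r M N g) (hN : Fintype.card V ≤ N) {u x : V}
    (hux : G.Adj x u) (hx : g.phase x = .counting) (hlt : g.cnt x + 2 < g.snt u x) :
    g.par x = some u := by
  by_contra hp
  have h1 := h.snt_eq_of_fresh hN hux (Or.inl hx) hp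
  have h2 := h.cnt_le u x hux.symm fun hpu => (h.par_adj u x hpu).2 (Or.inl hx)
  omega

/-- A node is explored only after it has completed `M` rounds. -/
theorem le_cnt_of_par (h : Inv G r M N g) {u x : V} (hx : g.Fresh x) (hp : g.par x = some u) :
    M ≤ g.cnt x := by
  obtain ⟨-, hd⟩ := h.pending x u hx hp
  obtain ⟨hadj, -, hle, -⟩ := h.done u x hd
  have h1 := h.rcv_le x u hadj.symm
  have h2 := h.fresh_snt x u hadj.symm hx
  omega

/-- If the node that `x` has explored has sent back a complete notification, the token returns to `x`:
a child on the stack would not have notified its parent yet. -/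
theorem head_of_done [Fintype V] (h : Inv G r M N g) (hN : Fintype.card V ≤ N) {u x : V}
    (hx : g.phase x = .done u) (hT : g.snt u x = M + N + 2) : ∃ l, g.stack = x :: l := by
  have hbound := h.cnt_lt hN u
  have hmem : x ∈ g.stack := (h.mem_stack x).2 (by simp [Net.Fresh, hx])
  cases hs : g.stack with
  | nil => simp [hs] at hmem
  | cons s l =>
    rcases List.mem_cons.1 (hs ▸ hmem) with rfl | hmem
    · exact ⟨l, rfl⟩
    · obtain ⟨a, ha, hxa, hax⟩ := (hs ▸ h.chain).above hmem
      obtain rfl : u = a := by simpa [hx] using hxa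
      have := (h.active_par u x (hs ▸ ha) hax).2
      omega

/-- While the token is held, the nodes that the DFS has not reached are still counting, with no
notification under way. -/
theorem counting_of_hold (h : Inv G r M N g) {x y : V} (hx : g.phase x = .hold) (hy : g.Fresh y) :
    g.phase y = .counting ∧ g.par y = none := by
  obtain ⟨l, hl⟩ := h.stack_eq_cons (Or.inl hx)
  have hnone : g.par y = none := by
    by_contra hne
    obtain ⟨s, hs⟩ := Option.ne_none_iff_exists'.1 hne
    obtain ⟨h1, h2⟩ := h.pending y s hy hs
    grind
  refine ⟨hy.resolve_right fun hy' => ?_, hnone⟩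
  have hne : y ≠ r := by
    rintro rfl
    exact h.root_ne_awaitExplore hy'
  exact h.par_ne_none y hne (by simp [hy']) hnone

/-- Nobody has sent a complete notification to the top of the stack across an edge that neither of
the two nodes has explored. -/
theorem snt_lt_of_head [Fintype V] (h : Inv G r M N g) (hN : Fintype.card V ≤ N) {u x : V}
    {l : List V} (hl : g.stack = x :: l) (hux : G.Adj x u) (hp : g.par x ≠ some u)
    (hd : g.phase x ≠ .done u) (hne : g.rcv u x ≠ M + N + 2) : g.snt u x < M + N + 2 := by
  have hx : x ∈ g.stack := by simp [hl]
  have h1 := h.active_unexplored x u hux hx hp hne hd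
  have h2 := h.rcv_le x u hux
  have h3 := h.cnt_lt hN x
  have h4 := h.cnt_lt hN u
  by_cases hf : g.Fresh u
  · have := h.fresh_snt u x hux.symm hf
    omega
  by_cases hfin : g.phase u = .finished
  · have := (h.finished u x hux.symm hfin).1
    omega
  have hu := (h.mem_stack u).2 ⟨hf, hfin⟩
  have hpu : g.par u ≠ some x := fun hpu => by
    have := (h.active_par u x hu hpu).1
    omega
  have hdu : g.phase u ≠ .done x := fun hdu => by
    have hul : u ∈ l := (List.mem_cons.1 (hl ▸ hu)).resolve_left hux.ne'
    obtain ⟨a, -, ha, hpa⟩ := (hl ▸ h.chain).above hul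
    obtain rfl : x = a := by simpa [hdu] using ha
    exact hp hpa
  have := h.active_unexplored u x hux.symm hu hpu (by omega) hdu
  omega

end Inv

/-! ### The actions preserve the invariant -/

/-- The two-argument function `f` with its value at `(u, v)` replaced by `n`. -/
def update₂ {V : Type*} [DecidableEq V] (f : V → V → ℕ) (u v : V) (n : ℕ) : V → V → ℕ :=
  fun a b => if a = u ∧ b = v then n else f a b

theorem update₂_apply {V : Type*} [DecidableEq V] (f : V → V → ℕ) (u v : V) (n : ℕ) (a b : V) :
    update₂ f u v n a b = if a = u ∧ b = v then n else f a b := rfl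

namespace Inv

variable [DecidableEq V]

/-- A pulse arrives and triggers nothing.  A counting node still has the same minimum, and a node that
waits to explore the edge to `u` needs more pulses from there. -/
theorem receive (h : Inv G r M N g) {u x : V} (hux : G.Adj x u)
    (hlt : g.rcv u x < g.snt u x) (hT : g.rcv u x + 1 < M + N + 2)
    (hc : g.phase x = .counting → ∃ w ≠ u, G.Adj x w ∧ g.rcv w x ≤ g.cnt x)
    (hr : g.phase x = .ready u → g.rcv u x + 1 ≤ M) :
    Inv G r M N { g with rcv := update₂ g.rcv u x (g.rcv u x + 1) } := by
  obtain ⟨h1, h2, h3, h4, h5, h6, h7, h8, h9, h10, h11, h12, h13, h14, h15, h16, h17, h18, h19,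
    h20, h21, h22, h23, h24, h25⟩ := h
  constructor <;> simp only [Net.Fresh, update₂_apply] at * <;> try assumption
  case chain => exact h15.congr (fun _ _ => rfl) (fun _ _ => rfl)
  all_goals grind

/-- A counting node receives a pulse that completes a round, and starts the next round. -/
theorem increment [Fintype V] (h : Inv G r M N g) (hN : Fintype.card V ≤ N) {u x : V}
    (hux : G.Adj x u) (hlt : g.rcv u x < g.snt u x) (hx : g.phase x = .counting)
    (hu : g.rcv u x = g.cnt x) (hw : ∀ w ≠ u, G.Adj x w → g.cnt x + 1 ≤ g.rcv w x)
    (hr : x = r → g.cnt x + 1 ≤ M) :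
    Inv G r M N { g with
      rcv := update₂ g.rcv u x (g.rcv u x + 1)
      cnt := Function.update g.cnt x (g.cnt x + 1)
      snt := fun a b => if a = x then g.snt a b + 1 else g.snt a b } := by
  have hbound := h.cnt_lt hN x
  have hsnt := fun y hy => h.snt_eq_of_fresh (u := y) hN hy (Or.inl hx)
  obtain ⟨h1, h2, h3, h4, h5, h6, h7, h8, h9, h10, h11, h12, h13, h14, h15, h16, h17, h18, h19,
    h20, h21, h22, h23, h24, h25⟩ := h
  constructor <;> simp only [Net.Fresh, update₂_apply, Function.update_apply] at * <;>
    try assumption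
  case chain => exact h15.congr (fun _ _ => rfl) (fun _ _ => rfl)
  case cnt_le =>
    intro a b hab hp
    have hle := h25 a b hab hp
    by_cases ha : a = x
    · subst ha
      have hs := hsnt b hab hp
      have hb := h1 b a hab.symm
      by_cases hbu : b = u
      · grind
      · have := hw b hbu hab
        grind
    · grind
  all_goals grind

/-- The root exits synchronized counting and holds the token. -/
theorem startLeader (h : Inv G r M N g) (hr : g.phase r = .counting) (hM : g.cnt r = M) :
    Inv G r M N { g with
      phase := Function.update g.phase r .hold
      stack := [r] } := by
  have hall := h.root_counting hr
  have hnil : g.stack = [] := List.eq_nil_iff_forall_not_mem.2 fun v hv =>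
    ((h.mem_stack v).1 hv).1 (Or.inl (hall v))
  obtain ⟨h1, h2, h3, h4, h5, h6, h7, h8, h9, h10, h11, h12, h13, h14, h15, h16, h17, h18, h19,
    h20, h21, h22, h23, h24, h25⟩ := h
  constructor <;> simp only [Net.Fresh, Function.update_apply] at * <;>
    try assumption
  case chain => rfl
  all_goals grind

/-- A counting node realizes that an explore-notification is arriving. -/
theorem becomeNonLeader (h : Inv G r M N g) {u x : V} (hx : g.phase x = .counting)
    (hp : g.par x = some u) :
    Inv G r M N { g with phase := Function.update g.phase x .awaitExplore } := by
  have hM := h.le_cnt_of_par (Or.inl hx) hp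
  obtain ⟨hhead, hdone⟩ := h.pending x u (Or.inl hx) hp
  obtain ⟨h1, h2, h3, h4, h5, h6, h7, h8, h9, h10, h11, h12, h13, h14, h15, h16, h17, h18, h19,
    h20, h21, h22, h23, h24, h25⟩ := h
  constructor <;> simp only [Net.Fresh, Function.update_apply] at * <;>
    try assumption
  case chain =>
    refine h15.congr (fun v hv => ?_) (fun _ _ => rfl)
    have := (h8 v).1 (List.mem_of_mem_tail hv)
    grind
  all_goals grind

/-- The explore-notification is complete, and the token moves on to the notified node. -/
theorem join [Fintype V] (h : Inv G r M N g) (hN : Fintype.card V ≤ N) {u x : V}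
    (hx : g.phase x = .awaitExplore) (hp : g.par x = some u)
    (hT : g.rcv u x + 1 = M + N + 2) :
    Inv G r M N { g with
      rcv := update₂ g.rcv u x (g.rcv u x + 1)
      phase := Function.update g.phase x .hold
      stack := x :: g.stack } := by
  have hbound := h.cnt_lt hN
  obtain ⟨hhead, hdone⟩ := h.pending x u (Or.inr hx) hp
  obtain ⟨l, hl⟩ : ∃ l, g.stack = u :: l := by
    cases hs : g.stack <;> simp_all
  have hxs : x ∉ g.stack := fun hxs => ((h.mem_stack x).1 hxs).1 (Or.inr hx)
  have hux := (h.par_adj x u hp).1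
  obtain ⟨h1, h2, h3, h4, h5, h6, h7, h8, h9, h10, h11, h12, h13, h14, h15, h16, h17, h18, h19,
    h20, h21, h22, h23, h24, h25⟩ := h
  constructor <;> simp only [Net.Fresh, update₂_apply, Function.update_apply] at * <;>
    try assumption
  case chain =>
    rw [hl] at h15 hxs ⊢
    refine ⟨hp, ?_, h15.congr (fun v hv => ?_) (fun _ _ => rfl)⟩ <;> grind
  all_goals grind

/-- The DFS comes in through a back edge, and the node replies. -/
theorem reply (h : Inv G r M N g) {u j x : V}
    (hx : g.phase x = .done j) (hj : u ≠ j) (hp : g.par x ≠ some u)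
    (hlt : g.rcv u x < g.snt u x) (hle : g.snt x u ≤ M + N + 2)
    (hT : g.rcv u x + 1 = M + N + 2) :
    Inv G r M N { g with
      rcv := update₂ g.rcv u x (g.rcv u x + 1)
      snt := update₂ g.snt x u (M + N + 2) } := by
  obtain ⟨h1, h2, h3, h4, h5, h6, h7, h8, h9, h10, h11, h12, h13, h14, h15, h16, h17, h18, h19,
    h20, h21, h22, h23, h24, h25⟩ := h
  constructor <;> simp only [Net.Fresh, update₂_apply] at * <;>
    try assumption
  case chain => exact h15.congr (fun _ _ => rfl) (fun _ _ => rfl)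
  all_goals grind

/-- The DFS returns from the port that is being explored. -/
theorem returnFrom [Fintype V] (h : Inv G r M N g) (hN : Fintype.card V ≤ N) {u x : V}
    (hx : g.phase x = .done u)
    (hlt : g.rcv u x < g.snt u x) (hT : g.rcv u x + 1 = M + N + 2) :
    Inv G r M N { g with
      rcv := update₂ g.rcv u x (g.rcv u x + 1)
      phase := Function.update g.phase x .hold } := by
  have hbound := h.cnt_lt hN
  have hux := (h.done x u hx).1
  have hsnt : g.snt u x = M + N + 2 := by
    have := h.snt_le hN hux.symm
    omega
  obtain ⟨l, hl⟩ := h.head_of_done hN hx hsnt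
  obtain ⟨h1, h2, h3, h4, h5, h6, h7, h8, h9, h10, h11, h12, h13, h14, h15, h16, h17, h18, h19,
    h20, h21, h22, h23, h24, h25⟩ := h
  constructor <;> simp only [Net.Fresh, update₂_apply, Function.update_apply] at * <;>
    try assumption
  case chain =>
    refine h15.congr (fun v hv => ?_) (fun _ _ => rfl)
    grind
  all_goals grind

/-- The token holder reconsiders the edge that it waits to explore. -/
theorem holdOfReady (h : Inv G r M N g) {j x : V} (hx : g.phase x = .ready j) :
    Inv G r M N { g with phase := Function.update g.phase x .hold } := by
  obtain ⟨l, hl⟩ := h.stack_eq_cons (Or.inr ⟨j, hx⟩)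
  obtain ⟨h1, h2, h3, h4, h5, h6, h7, h8, h9, h10, h11, h12, h13, h14, h15, h16, h17, h18, h19,
    h20, h21, h22, h23, h24, h25⟩ := h
  constructor <;> simp only [Net.Fresh, Function.update_apply] at * <;>
    try assumption
  case chain =>
    refine h15.congr (fun v hv => ?_) (fun _ _ => rfl)
    grind
  all_goals grind

/-- The token holder waits for its neighbour `j` to complete round `M`. -/
theorem readyOfHold (h : Inv G r M N g) {j x : V} (hx : g.phase x = .hold) (hj : G.Adj x j)
    (hp : g.par x ≠ some j) (hle : g.rcv j x ≤ M) :
    Inv G r M N { g with phase := Function.update g.phase x (.ready j) } := by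
  obtain ⟨l, hl⟩ := h.stack_eq_cons (Or.inl hx)
  obtain ⟨h1, h2, h3, h4, h5, h6, h7, h8, h9, h10, h11, h12, h13, h14, h15, h16, h17, h18, h19,
    h20, h21, h22, h23, h24, h25⟩ := h
  constructor <;> simp only [Net.Fresh, Function.update_apply] at * <;>
    try assumption
  case chain =>
    refine h15.congr (fun v hv => ?_) (fun _ _ => rfl)
    grind
  all_goals grind

/-- The token holder explores an edge to a node that the DFS has reached already. -/
theorem exploreBack (h : Inv G r M N g) {j x : V} (hx : g.phase x = .hold) (hj : G.Adj x j)
    (hp : g.par x ≠ some j) (hf : ¬ g.Fresh j) (hle : M + 1 ≤ g.rcv j x)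
    (hlt : g.rcv j x < M + N + 2) (hsnt : g.snt x j ≤ M + N + 2) :
    Inv G r M N { g with
      phase := Function.update g.phase x (.done j)
      snt := update₂ g.snt x j (M + N + 2) } := by
  obtain ⟨l, hl⟩ := h.stack_eq_cons (Or.inl hx)
  obtain ⟨h1, h2, h3, h4, h5, h6, h7, h8, h9, h10, h11, h12, h13, h14, h15, h16, h17, h18, h19,
    h20, h21, h22, h23, h24, h25⟩ := h
  constructor <;> simp only [Net.Fresh, update₂_apply, Function.update_apply] at * <;>
    try assumption
  case chain =>
    refine h15.congr (fun v hv => ?_) (fun _ _ => rfl)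
    grind
  all_goals grind

/-- Making the token holder `x` the parent of a fresh neighbour `j` does not confine any set `X` of
nodes, say with `j ∈ X` and `x ∉ X`.  As `G` is 2-edge-connected, the fresh part of `X` is left by
another edge.  If that edge leaves `X`, it is as required.  Otherwise it ends in a node of `X` that is
on the stack, because finished nodes have no fresh neighbours; and somewhere between this node and
`x` the stack leaves `X`, along an edge from a parent to its child. -/
theorem escapes_update (h : Inv G r M N g) (hG : G.IsEdgeConnected 2) {j x : V}
    (hx : g.phase x = .hold) (hf : g.Fresh j) (hN : ∀ v, g.cnt v < M + N) :
    Escapes G r (Function.update g.par j (some x)) := by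
  intro X hr hne
  obtain ⟨l, hl⟩ := h.stack_eq_cons (Or.inl hx)
  by_cases hX : j ∈ X ∧ x ∉ X
  · obtain ⟨y, ⟨hyX, hyf⟩, z, hz, hyz, hne⟩ := exists_adj_ne_of_isEdgeConnected_two hG
      (X := {v | v ∈ X ∧ g.Fresh v}) (x := j) (r := r) ⟨hX.1, hf⟩ (fun hr' => hr hr'.1) s(j, x)
    by_cases hzX : z ∈ X
    · have hzf : ¬ g.Fresh z := fun hzf => hz ⟨hzX, hzf⟩
      have hzs : z ∈ g.stack := by
        refine (h.mem_stack z).2 ⟨hzf, fun hfin => ?_⟩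
        have h1 := (h.finished z y hyz.symm hfin).1
        have h2 := h.rcv_le y z hyz
        have h3 := h.fresh_snt y z hyz hyf
        have h4 := hN y
        omega
      have hzl : z ∈ l := by grind
      obtain ⟨a, ha, b, hb, hbl, hba⟩ := (hl ▸ h.chain).exists_boundary hX.2 hzl hzX
      obtain ⟨hadj, hpar, -⟩ := h.done b a hba
      refine ⟨b, hb, a, ha, hadj, ?_⟩
      have hbj : b ≠ j := by
        rintro rfl
        exact ((h.mem_stack b).1 (by simp [hl, hbl])).1 hf
      simpa [Function.update_apply, hbj] using hpar
    · refine ⟨y, hyX, z, hzX, hyz, ?_⟩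
      have := (h.counting_of_hold hx hyf).2
      grind
  · obtain ⟨a, ha, b, hb, hab, hp⟩ := h.escapes X hr hne
    refine ⟨a, ha, b, hb, hab, ?_⟩
    grind

/-- The token holder sends an explore-notification to a node that is still counting. -/
theorem exploreTree [Fintype V] (h : Inv G r M N g) (hN : Fintype.card V ≤ N)
    (hG : G.IsEdgeConnected 2) {j x : V} (hx : g.phase x = .hold)
    (hj : G.Adj x j) (hf : g.Fresh j) (hle : M + 1 ≤ g.rcv j x)
    (hlt : g.rcv j x < M + N + 2) :
    Inv G r M N { g with
      phase := Function.update g.phase x (.done j)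
      snt := update₂ g.snt x j (M + N + 2)
      par := Function.update g.par j (some x) } := by
  have hsnt := h.snt_le hN hj
  have hfresh := fun y => h.counting_of_hold (y := y) hx
  have hj' := hj.symm
  have hesc := h.escapes_update hG hx hf (h.cnt_lt hN)
  obtain ⟨l, hl⟩ := h.stack_eq_cons (Or.inl hx)
  obtain ⟨h1, h2, h3, h4, h5, h6, h7, h8, h9, h10, h11, h12, h13, h14, h15, h16, h17, h18, h19,
    h20, h21, h22, h23, h24, h25⟩ := h
  constructor <;> simp only [Net.Fresh, update₂_apply, Function.update_apply] at * <;>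
    try assumption
  case chain =>
    refine h15.congr (fun v hv => ?_) (fun v hv => ?_)
    · grind
    · have hvj : v ≠ j := fun hvj => ((h8 v).1 hv).1 (hvj ▸ hf)
      exact Function.update_of_ne hvj _ _
  all_goals grind

/-- The root finishes; it has no parent to notify. -/
theorem finishRoot (h : Inv G r M N g) {x : V} (hx : g.phase x = .hold) (hp : g.par x = none)
    (hall : ∀ u, G.Adj x u → g.rcv u x = M + N + 2) :
    Inv G r M N { g with
      phase := Function.update g.phase x .finished
      stack := g.stack.tail } := by
  have hfresh := fun y => h.counting_of_hold (y := y) hx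
  obtain ⟨l, hl⟩ := h.stack_eq_cons (Or.inl hx)
  obtain ⟨h1, h2, h3, h4, h5, h6, h7, h8, h9, h10, h11, h12, h13, h14, h15, h16, h17, h18, h19,
    h20, h21, h22, h23, h24, h25⟩ := h
  constructor <;> simp only [Net.Fresh, Function.update_apply] at * <;>
    try assumption
  case chain =>
    rw [hl] at h15 h16 ⊢
    have h15' : g.Chain r l := by
      cases l with
      | nil => trivial
      | cons b l => exact h15.2.2
    have hxl : x ∉ l := (List.nodup_cons.1 h16).1
    refine h15'.congr (fun v hv => ?_) (fun v hv => rfl)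
    have hvl := List.mem_of_mem_tail hv
    grind
  all_goals grind

/-- A child finishes and sends the done-notification to its parent. -/
theorem finishChild (h : Inv G r M N g) {x p : V} (hx : g.phase x = .hold) (hp : g.par x = some p)
    (hle : g.snt x p ≤ M + N + 2)
    (hall : ∀ u, G.Adj x u → u ≠ p → g.rcv u x = M + N + 2) :
    Inv G r M N { g with
      phase := Function.update g.phase x .finished
      snt := update₂ g.snt x p (M + N + 2)
      stack := g.stack.tail } := by
  have hfresh := fun y => h.counting_of_hold (y := y) hx
  obtain ⟨l, hl⟩ := h.stack_eq_cons (Or.inl hx)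
  obtain ⟨h1, h2, h3, h4, h5, h6, h7, h8, h9, h10, h11, h12, h13, h14, h15, h16, h17, h18, h19,
    h20, h21, h22, h23, h24, h25⟩ := h
  constructor <;> simp only [Net.Fresh, update₂_apply, Function.update_apply] at * <;>
    try assumption
  case chain =>
    rw [hl] at h15 h16 ⊢
    have h15' : g.Chain r l := by
      cases l with
      | nil => trivial
      | cons b l => exact h15.2.2
    have hxl : x ∉ l := (List.nodup_cons.1 h16).1
    refine h15'.congr (fun v hv => ?_) (fun v hv => rfl)
    have hvl := List.mem_of_mem_tail hv
    grind
  all_goals grind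

end Inv

end Snapshots

section Extremal

variable {V : Type*} {G : SimpleGraph V} {r : V} {M N : ℕ} {g : Net V}

/-! ### The initial and the final snapshot -/

/-- All nodes are counting and have sent their first pulses. -/
def Net.start : Net V where
  phase _ := .counting
  cnt _ := 0
  snt _ _ := 1
  rcv _ _ := 0
  par _ := none
  stack := []

theorem Inv.start [Nontrivial V] (hG : G.IsEdgeConnected 2) : Inv G r M N Net.start := by
  constructor
  case escapes =>
    rintro X hr ⟨x, hx⟩
    obtain ⟨y, hy, z, hz, hyz, -⟩ := exists_adj_ne_of_isEdgeConnected_two hG hx hr s(x, x)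
    exact ⟨y, hy, z, hz, hyz, by simp [Net.start]⟩
  case counting_ex =>
    intro v _
    obtain ⟨u, hu⟩ := exists_adj_of_isEdgeConnected_two hG v
    exact ⟨u, hu, le_rfl⟩
  all_goals simp [Net.start, Net.Fresh, Net.Chain]

/-- The neighbours of a finished node are not fresh, so with an empty stack they are finished too. -/
theorem Inv.all_finished [Fintype V] (h : Inv G r M N g) (hN : Fintype.card V ≤ N)
    (hG : G.IsEdgeConnected 2) (hr : g.phase r = .finished) (v : V) : g.phase v = .finished := by
  have hstack : g.stack = [] := by
    cases hs : g.stack with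
    | nil => rfl
    | cons s l =>
      have hmem := (hs ▸ h.chain).root_mem
      exact absurd hr ((h.mem_stack r).1 (hs ▸ hmem)).2
  by_contra hv
  obtain ⟨y, hy, z, hz, hyz, -⟩ := exists_adj_ne_of_isEdgeConnected_two hG
    (X := {v | g.phase v ≠ .finished}) (x := v) (r := r) hv (fun hn => hn hr) s(v, v)
  have hz : g.phase z = .finished := not_not.1 hz
  have hy : g.phase y ≠ .finished := hy
  have hf : g.Fresh y := by
    by_contra hf
    have := (h.mem_stack y).2 ⟨hf, hy⟩
    simp [hstack] at this
  have h1 := (h.finished z y hyz.symm hz).1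
  have h2 := h.rcv_le y z hyz
  have h3 := h.fresh_snt y z hyz hf
  have h4 := h.cnt_lt hN y
  omega

/-- A counting node with the smallest counter, if below `M`, has received one more pulse from each
neighbour once nothing is in transit. -/
theorem Inv.le_cnt_of_quiescent [Fintype V] (h : Inv G r M N g)
    (hq : ∀ u v, G.Adj u v → g.rcv u v = g.snt u v) (hN : Fintype.card V ≤ N) (v : V) :
    M ≤ g.cnt v := by
  obtain ⟨x, -, hx⟩ := Finset.exists_min_image Finset.univ g.cnt ⟨v, Finset.mem_univ v⟩
  refine le_trans ?_ (hx v (Finset.mem_univ v))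
  by_contra! hlt
  have hc : g.phase x = .counting := by
    by_contra hc
    exact absurd (h.le_cnt x hc) (by omega)
  obtain ⟨u, hu, hle⟩ := h.counting_ex x hc
  rw [hq u x hu.symm] at hle
  by_cases hp : g.par x = some u
  · have := h.le_cnt_of_par (Or.inl hc) hp
    omega
  · have h1 := h.snt_eq_of_fresh hN hu (Or.inl hc) hp
    have h2 := hx u (Finset.mem_univ u)
    omega

/-- The algorithm is free of deadlocks: the token holder never waits in vain. -/
theorem Inv.all_finished_of_quiescent [Fintype V] (h : Inv G r M N g) (hN : Fintype.card V ≤ N)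
    (hG : G.IsEdgeConnected 2) (hq : ∀ u v, G.Adj u v → g.rcv u v = g.snt u v)
    (hhold : ∀ v, g.phase v ≠ .hold) (hr : g.phase r = .counting → g.cnt r < M) (v : V) :
    g.phase v = .finished := by
  have hM := h.le_cnt_of_quiescent hq hN
  have hlt := h.cnt_lt hN
  have hrc : g.phase r ≠ .counting := fun hc => absurd (hM r) (by have := hr hc; omega)
  refine h.all_finished hN hG ?_ v
  by_contra hrf
  have hrs : r ∈ g.stack := (h.mem_stack r).2
    ⟨fun hf => hf.elim hrc h.root_ne_awaitExplore, hrf⟩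
  obtain ⟨s, l, hs⟩ : ∃ s l, g.stack = s :: l := List.exists_cons_of_ne_nil (List.ne_nil_of_mem hrs)
  have hss : s ∈ g.stack := by simp [hs]
  have hsx : ∀ x, G.Adj s x → M + 1 ≤ g.snt x s := by
    intro x hx
    have := hM x
    by_cases hf : g.Fresh x
    · have := h.fresh_snt x s hx.symm hf
      omega
    by_cases hfin : g.phase x = .finished
    · have := (h.finished x s hx.symm hfin).2
      omega
    have hxs := (h.mem_stack x).2 ⟨hf, hfin⟩
    by_cases hp : g.par x = some s
    · have := (h.active_par x s hxs hp).2
      omega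
    by_cases hr : g.rcv s x = M + N + 2
    · have := h.active_explored x s hx.symm hxs hp hr
      omega
    by_cases hd : g.phase x = .done s
    · have := (h.done x s hd).2.2.2.2
      omega
    · have := h.active_unexplored x s hx.symm hxs hp hr hd
      omega
  obtain ⟨hsf, hsfin⟩ := (h.mem_stack s).1 hss
  cases hps : g.phase s with
  | counting => exact hsf (Or.inl hps)
  | awaitExplore => exact hsf (Or.inr hps)
  | hold => exact hhold s hps
  | finished => exact hsfin hps
  | ready j =>
    obtain ⟨hj, -, hle⟩ := h.ready s j hps
    have := hsx j hj
    have := hq j s hj.symm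
    omega
  | done x =>
    obtain ⟨hx, hpx, -, hxlt, hsnt⟩ := h.done s x hps
    have h1 := hq s x hx
    have h2 := hq x s hx.symm
    -- `x` has the whole notification, so it has replied or finished
    by_cases hf : g.Fresh x
    · have := h.fresh_rcv x s hx.symm hf
      omega
    by_cases hfin : g.phase x = .finished
    · have := (h.finished x s hx.symm hfin).2
      omega
    have hxs := (h.mem_stack x).2 ⟨hf, hfin⟩
    by_cases hp : g.par x = some s
    · have hmem := h.chain.par_mem hxs h.par_root hp
      have hnd := h.nodup
      rw [hs] at hmem hnd
      exact (List.nodup_cons.1 hnd).1 hmem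
    · have := h.active_explored x s hx.symm hxs hp (by omega)
      omega

end Extremal

section LocalStates

/-! ### The local algorithm -/

namespace NodeState

theorem sigma_le_sendNotification (s : NodeState) (i p : ℕ) :
    s.sigma p ≤ (s.sendNotification i).sigma p := by
  simp only [sendNotification, Function.update_apply]
  split_ifs with h
  · exact h ▸ le_max_left _ _
  · exact le_rfl

theorem sigma_le_tryExplore (s : NodeState) (j p : ℕ) : s.sigma p ≤ (s.tryExplore j).sigma p := by
  unfold tryExplore
  split_ifs
  · exact s.sigma_le_sendNotification j p
  · exact le_rfl

theorem sigma_le_finish (s : NodeState) (p : ℕ) : s.sigma p ≤ s.finish.sigma p := by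
  unfold finish
  split
  · exact s.sigma_le_sendNotification _ p
  · exact le_rfl

theorem sigma_le_nextPort (s : NodeState) (p : ℕ) : s.sigma p ≤ s.nextPort.sigma p := by
  unfold nextPort
  split_ifs
  · exact s.sigma_le_tryExplore _ p
  · exact s.sigma_le_finish p

theorem sigma_le_tryJoin (s : NodeState) (p : ℕ) : s.sigma p ≤ s.tryJoin.sigma p := by
  unfold tryJoin
  split_ifs
  · exact s.sigma_le_nextPort p
  · exact le_rfl

theorem sigma_le_increment (s : NodeState) (p : ℕ) : s.sigma p ≤ s.increment.sigma p := by
  unfold increment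
  dsimp only
  split_ifs
  · refine le_trans ?_ (sigma_le_nextPort _ p)
    exact Nat.le_succ _
  · exact Nat.le_succ _

theorem sigma_le_react (s : NodeState) (i p : ℕ) : s.sigma p ≤ (s.react i).sigma p := by
  unfold react
  split
  · split_ifs
    · exact s.sigma_le_increment p
    · refine le_trans ?_ (sigma_le_tryJoin _ p)
      exact le_rfl
    · exact le_rfl
  · exact s.sigma_le_tryJoin p
  · exact s.sigma_le_tryExplore _ p
  · dsimp only
    split_ifs
    · refine le_trans ?_ (sigma_le_nextPort _ p)
      exact le_rfl
    · refine le_trans ?_ (sigma_le_sendNotification _ _ p)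
      exact le_rfl
    · exact le_rfl
  · exact le_rfl

theorem sigma_le_receive (s : NodeState) (i p : ℕ) : s.sigma p ≤ (s.receive i).sigma p := by
  refine le_trans ?_ (sigma_le_react _ i p)
  exact le_rfl

theorem tryExplore_rho (s : NodeState) (j : ℕ) : (s.tryExplore j).rho = s.rho := by
  unfold tryExplore
  split_ifs <;> rfl

theorem nextPort_rho (s : NodeState) : s.nextPort.rho = s.rho := by
  unfold nextPort finish
  split
  · exact s.tryExplore_rho _
  · split <;> rfl

theorem tryJoin_rho (s : NodeState) : s.tryJoin.rho = s.rho := by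
  unfold tryJoin
  split_ifs
  · exact s.nextPort_rho
  · rfl

theorem react_rho (s : NodeState) (i : ℕ) : (s.react i).rho = s.rho := by
  unfold react
  split
  · split_ifs
    · unfold increment
      dsimp only
      split_ifs
      · exact nextPort_rho _
      · rfl
    · exact tryJoin_rho _
    · rfl
  · exact s.tryJoin_rho
  · exact s.tryExplore_rho _
  · dsimp only
    split_ifs
    · exact nextPort_rho _
    · rfl
    · rfl
  · rfl

theorem receive_rho (s : NodeState) (i : ℕ) :
    (s.receive i).rho = Function.update s.rho i (s.rho i + 1) :=
  react_rho _ i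

end NodeState

/-! ### Local states and snapshots -/

/-- The snapshots `g` and `g'` do not differ in what the node `v` knows. -/
structure AgreeAt {V : Type*} (g g' : Net V) (v : V) : Prop where
  phase : g'.phase v = g.phase v
  cnt : g'.cnt v = g.cnt v
  snt : g'.snt v = g.snt v
  rcv : ∀ u, g'.rcv u v = g.rcv u v
  par : g.phase v ≠ .counting → g'.par v = g.par v

theorem AgreeAt.trans {V : Type*} {g g' g'' : Net V} {v : V} (h : AgreeAt g g' v)
    (h' : AgreeAt g' g'' v) : AgreeAt g g'' v where
  phase := h'.phase.trans h.phase
  cnt := h'.cnt.trans h.cnt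
  snt := h'.snt.trans h.snt
  rcv u := (h'.rcv u).trans (h.rcv u)
  par hv := (h'.par (h.phase ▸ hv)).trans (h.par hv)

variable {V : Type*} [Fintype V] {G : SimpleGraph V} [DecidableRel G.Adj] {L : Labeling G}
  {r : V} {N : ℕ} {g : Net V}

theorem Labeling.port_inj (L : Labeling G) {v a b : V} (ha : G.Adj v a) (hb : G.Adj v b) :
    L.port v a = L.port v b ↔ a = b :=
  ⟨fun h => (L.port_bijOn v).injOn ha hb h, fun h => h ▸ rfl⟩

theorem Labeling.mem_ports_iff (L : Labeling G) {v : V} {s : NodeState}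
    (hs : s.deg = G.degree v) {i : ℕ} : i ∈ s.ports ↔ ∃ u, G.Adj v u ∧ L.port v u = i := by
  have := Set.ext_iff.1 (L.port_bijOn v).image_eq i
  simp only [Set.mem_image, SimpleGraph.mem_neighborSet, Set.mem_Icc] at this
  rw [NodeState.ports, Finset.mem_Icc, hs, this]

/-- The stage of `v` is the given phase.  Nothing is required of `hold`, because a token holder
overwrites its stage before its action ends. -/
def StageMatches (L : Labeling G) (v : V) : Phase V → Stage → Prop
  | .counting, t => t = .counting
  | .awaitExplore, t => t = .awaitExplore
  | .hold, _ => True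
  | .ready j, t => t = .awaitReady (L.port v j)
  | .done j, t => t = .awaitDone (L.port v j)
  | .finished, t => t = .finished

/-- The local state `s` of the node `v` agrees with the snapshot `g`. -/
structure Represents [DecidableEq V] (L : Labeling G) (r : V) (N : ℕ) (g : Net V) (v : V)
    (s : NodeState) : Prop where
  bound : s.bound = N
  scaledId : s.scaledId = L.id v * N
  deg : s.deg = G.degree v
  sigma : ∀ u, G.Adj v u → s.sigma (L.port v u) = g.snt v u
  rho : ∀ u, G.Adj v u → s.rho (L.port v u) = g.rcv u v
  count : s.count = g.cnt v
  role : g.phase v ≠ .counting → s.role = some (if v = r then .leader else .nonLeader)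
  leaderId : g.phase v ≠ .counting → s.leaderId = L.id r * N
  parent : ∀ p, g.phase v ≠ .counting → g.par v = some p → s.parent = L.port v p
  unexplored : g.phase v ≠ .counting → g.phase v ≠ .finished → ∀ i, i ∈ s.unexplored ↔
    ∃ u, G.Adj v u ∧ L.port v u = i ∧ g.par v ≠ some u ∧ g.rcv u v ≠ L.id r * N + N + 2
  stage : StageMatches L v (g.phase v) s.stage
  count_lt : g.phase v = .counting → s.count < s.scaledId

variable [DecidableEq V]

theorem Represents.congr {g g' : Net V} {v : V} {s : NodeState} (hs : Represents L r N g v s)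
    (h : AgreeAt g g' v) : Represents L r N g' v s := by
  obtain ⟨h1, h2, h3, h4, h5, h6, h7, h8, h9, h10, h11, h12⟩ := hs
  obtain ⟨a1, a2, a3, a4, a5⟩ := h
  constructor <;> (try simp only [a1, a2, a3, a4]) <;> try assumption
  · intro p hp
    rw [a5 hp]
    exact h9 p hp
  · intro hp
    rw [a5 hp]
    exact h10 hp

theorem Represents.threshold {v : V} {s : NodeState} (hs : Represents L r N g v s)
    (hv : g.phase v ≠ .counting) : s.threshold = L.id r * N + N + 2 := by
  rw [NodeState.threshold, hs.leaderId hv, hs.bound]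

/-- An action that turns the local state of `x` into `s` is correct in the snapshot `g`: it leads to a
snapshot that satisfies the invariant, and does not affect the other nodes. -/
def ActsWell (L : Labeling G) (r : V) (N : ℕ) (g : Net V) (x : V) (s : NodeState) : Prop :=
  ∃ g', Inv G r (L.id r * N) N g' ∧ (∀ v ≠ x, AgreeAt g g' v) ∧ g'.phase x ≠ .hold ∧
    Represents L r N g' x s

theorem ActsWell.of_agreeAt {g g' : Net V} {x : V} {s : NodeState} (h : ActsWell L r N g' x s)
    (hg : ∀ v ≠ x, AgreeAt g g' v) : ActsWell L r N g x s := by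
  obtain ⟨g'', h1, h2, h3⟩ := h
  exact ⟨g'', h1, fun v hv => (hg v hv).trans (h2 v hv), h3⟩

theorem Represents.sigma_sendNotification {x j : V} {s : NodeState}
    (hs : Represents L r N g x s) (hx : g.phase x ≠ .counting) (hj : G.Adj x j)
    (hle : g.snt x j ≤ L.id r * N + N + 2) (u : V) (hu : G.Adj x u) :
    (s.sendNotification (L.port x j)).sigma (L.port x u) =
      update₂ g.snt x j (L.id r * N + N + 2) x u := by
  simp only [NodeState.sendNotification, Function.update_apply, L.port_inj hu hj, update₂_apply,
    hs.threshold hx, hs.sigma j hj, hs.sigma u hu, max_eq_right hle, true_and]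

/-- The token holder explores an unexplored edge, or waits until it may do so. -/
theorem tryExplore_actsWell (hN : Fintype.card V ≤ N) (hG : G.IsEdgeConnected 2)
    (h : Inv G r (L.id r * N) N g) {x j : V} {s : NodeState} (hs : Represents L r N g x s)
    (hx : g.phase x = .hold) (hj : G.Adj x j) (hp : g.par x ≠ some j)
    (hne : g.rcv j x ≠ L.id r * N + N + 2) :
    ActsWell L r N g x (s.tryExplore (L.port x j)) := by
  have hxc : g.phase x ≠ .counting := by simp [hx]
  have hle := h.snt_le hN hj
  have hsig := hs.sigma_sendNotification hxc hj hle
  have hlt : g.rcv j x < L.id r * N + N + 2 :=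
    ((h.rcv_le j x hj.symm).trans (h.snt_le hN hj.symm)).lt_of_ne hne
  unfold NodeState.tryExplore
  rw [hs.leaderId hxc, hs.rho j hj]
  obtain ⟨h1, h2, h3, h4, h5, h6, h7, h8, h9, h10, h11, h12⟩ := hs
  split_ifs with hM
  · by_cases hf : g.Fresh j
    · refine ⟨_, h.exploreTree hN hG hx hj hf hM hlt, fun v hv => ?_, by simp, ?_⟩
      · have := h.counting_of_hold hx hf
        constructor <;> grind [update₂_apply]
      · have hjx : x ≠ j := hj.ne
        constructor <;> first
          | assumption
          | simp_all [StageMatches, NodeState.sendNotification]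
    · refine ⟨_, h.exploreBack hx hj hp hf hM hlt hle, fun v hv => ?_, by simp, ?_⟩
      · constructor <;> grind [update₂_apply]
      · constructor <;> first
          | assumption
          | simp_all [StageMatches, NodeState.sendNotification]
  · refine ⟨_, h.readyOfHold hx hj hp (by omega), fun v hv => ?_, by simp, ?_⟩
    · constructor <;> grind
    · constructor <;> first
        | assumption
        | simp_all [StageMatches]

/-- The token holder moves on to its next unexplored edge, or finishes. -/
theorem nextPort_actsWell (hN : Fintype.card V ≤ N) (hG : G.IsEdgeConnected 2)
    (h : Inv G r (L.id r * N) N g) {x : V} {s : NodeState} (hs : Represents L r N g x s)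
    (hx : g.phase x = .hold) : ActsWell L r N g x s.nextPort := by
  have hxc : g.phase x ≠ .counting := by simp [hx]
  have hun := hs.unexplored hxc (by simp [hx])
  unfold NodeState.nextPort
  split_ifs with hne
  · obtain ⟨j, hj, hji, hp, hr⟩ := (hun _).1 (s.unexplored.min'_mem hne)
    rw [← hji]
    exact tryExplore_actsWell hN hG h hs hx hj hp hr
  · have hall : ∀ u, G.Adj x u → g.par x ≠ some u → g.rcv u x = L.id r * N + N + 2 := by
      intro u hu hp
      by_contra hr
      exact hne ⟨_, (hun _).2 ⟨u, hu, rfl, hp, hr⟩⟩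
    have hrole := hs.role hxc
    unfold NodeState.finish
    by_cases hxr : x = r
    · subst hxr
      rw [if_pos rfl] at hrole
      rw [hrole]
      refine ⟨_, h.finishRoot hx h.par_root (fun u hu => hall u hu (by simp [h.par_root])),
        fun v hv => ?_, by simp, ?_⟩
      · constructor <;> grind
      · obtain ⟨h1, h2, h3, h4, h5, h6, h7, h8, h9, h10, h11, h12⟩ := hs
        constructor <;> first
          | assumption
          | simp_all [StageMatches]
    · rw [if_neg hxr] at hrole
      rw [hrole]
      obtain ⟨p, hp⟩ := Option.ne_none_iff_exists'.1 (h.par_ne_none x hxr hxc)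
      have hxp := (h.par_adj x p hp).1
      have hle := h.snt_le hN hxp
      have hsig := hs.sigma_sendNotification hxc hxp hle
      refine ⟨_, h.finishChild hx hp hle (fun u hu hup => hall u hu (by simp [hp, hup.symm])),
        fun v hv => ?_, by simp, ?_⟩
      · constructor <;> grind [update₂_apply]
      · obtain ⟨h1, h2, h3, h4, h5, h6, h7, h8, h9, h10, h11, h12⟩ := hs
        rw [← h9 p hxc hp] at hsig
        constructor <;> first
          | assumption
          | simp_all [StageMatches, NodeState.sendNotification]

end LocalStates

section Reactions

/-! ### The reaction to a pulse -/

/-- The snapshot after the arrival of a pulse on the edge from `u` to `x`. -/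
def Net.bump {V : Type*} [DecidableEq V] (g : Net V) (u x : V) : Net V :=
  { g with rcv := update₂ g.rcv u x (g.rcv u x + 1) }

theorem Net.agreeAt_bump {V : Type*} [DecidableEq V] (g : Net V) {u x v : V} (hv : v ≠ x) :
    AgreeAt g (g.bump u x) v := by
  constructor <;> simp [Net.bump, update₂_apply, hv]

variable {V : Type*} [Fintype V] {G : SimpleGraph V} [DecidableRel G.Adj] {L : Labeling G}
  {r : V} {N : ℕ} {g : Net V} [DecidableEq V]

/-- The local state after the arrival of a pulse on port `i`, before the reaction. -/
def NodeState.bump (s : NodeState) (i : ℕ) : NodeState :=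
  { s with rho := Function.update s.rho i (s.rho i + 1) }

theorem Represents.bump_rho {u x : V} {s : NodeState} (hs : Represents L r N g x s)
    (hux : G.Adj x u) (w : V) (hw : G.Adj x w) :
    (s.bump (L.port x u)).rho (L.port x w) = (g.bump u x).rcv w x := by
  simp only [NodeState.bump, Net.bump, Function.update_apply, L.port_inj hw hux, update₂_apply,
    hs.rho u hux, hs.rho w hw, and_true]

/-- Counting the pulse does not affect which edges are unexplored, unless it completes a notification
from a node other than the parent. -/
theorem Represents.bump {u x : V} {s : NodeState} (hs : Represents L r N g x s)
    (hux : G.Adj x u) (hne : g.rcv u x ≠ L.id r * N + N + 2)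
    (hne' : g.par x ≠ some u → g.rcv u x + 1 ≠ L.id r * N + N + 2) :
    Represents L r N (g.bump u x) x (s.bump (L.port x u)) := by
  have hrho := hs.bump_rho hux
  obtain ⟨h1, h2, h3, h4, h5, h6, h7, h8, h9, h10, h11, h12⟩ := hs
  constructor <;> try assumption
  intro hc hf i
  refine (h10 hc hf i).trans (exists_congr fun w => ?_)
  by_cases hw : w = u
  · subst hw
    simp only [Net.bump, update₂_apply, and_self, if_true]
    tauto
  · simp only [Net.bump, update₂_apply, hw, false_and, if_false]

/-- A node that waits for the rest of its explore-notification reacts correctly. -/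
theorem tryJoin_actsWell (hN : Fintype.card V ≤ N) (hG : G.IsEdgeConnected 2)
    (h : Inv G r (L.id r * N) N g) {u x : V} {s : NodeState}
    (hx : g.phase x = .awaitExplore) (hux : G.Adj x u) (hlt : g.rcv u x < g.snt u x)
    (hs : Represents L r N (g.bump u x) x s) : ActsWell L r N g x s.tryJoin := by
  have hxf : g.Fresh x := Or.inr hx
  have hxr : x ≠ r := fun hxr => h.root_ne_awaitExplore (hxr ▸ hx)
  obtain ⟨p, hp⟩ := Option.ne_none_iff_exists'.1 (h.par_ne_none x hxr (by simp [hx]))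
  have hxp := (h.par_adj x p hp).1
  have hpar : s.parent = L.port x p := hs.parent p (by simp [Net.bump, hx]) hp
  have hT : s.threshold = L.id r * N + N + 2 := hs.threshold (by simp [Net.bump, hx])
  have hrho := hs.rho p hxp
  have hcl := h.cnt_lt hN
  unfold NodeState.tryJoin
  rw [hpar, hT, hrho]
  have hrlt := h.fresh_rcv x p hxp hxf
  split_ifs with hc
  · -- only a pulse from the parent can complete the notification
    obtain rfl : p = u := by
      by_contra hpu
      simp [Net.bump, update₂_apply, hpu] at hc
      omega
    have hc' : g.rcv p x + 1 = L.id r * N + N + 2 := by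
      simpa [Net.bump, update₂_apply] using hc
    refine (nextPort_actsWell hN hG (h.join hN hx hp hc') ?_ (by simp)).of_agreeAt ?_
    · have hrcv := fun w hw => h.fresh_rcv x w hw hxf
      obtain ⟨h1, h2, h3, h4, h5, h6, h7, h8, h9, h10, h11, h12⟩ := hs
      constructor <;> simp_all [StageMatches, Net.bump, update₂_apply]
    · intro v hv
      constructor <;> grind [update₂_apply]
  · have hsl := h.snt_le hN hux.symm
    have hlt' : g.rcv u x + 1 < L.id r * N + N + 2 := by
      by_cases hup : u = p
      · subst hup
        simp [Net.bump, update₂_apply] at hc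
        omega
      · have := h.snt_eq_of_fresh hN hux hxf (by simp [hp, Ne.symm hup])
        have := hcl u
        omega
    exact ⟨g.bump u x, h.receive hux hlt hlt' (by simp [hx]) (by simp [hx]),
      fun v hv => g.agreeAt_bump hv, by simp [Net.bump, hx], hs⟩


/-- A counting node reacts correctly: only `r` can reach its scaled identifier, and a node that stops
counting otherwise does so because of an explore-notification and knows `M`. -/
theorem counting_actsWell (hN : Fintype.card V ≤ N) (hG : G.IsEdgeConnected 2)
    (hmin : ∀ v, L.id r ≤ L.id v) (h : Inv G r (L.id r * N) N g) {u x : V} {s : NodeState}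
    (hs : Represents L r N g x s) (hux : G.Adj x u) (hlt : g.rcv u x < g.snt u x)
    (hx : g.phase x = .counting) : ActsWell L r N g x (s.receive (L.port x u)) := by
  have hcl := h.cnt_lt hN
  have hxf : g.Fresh x := Or.inl hx
  have hstage : s.stage = .counting := by simpa [hx, StageMatches] using hs.stage
  have hrho := hs.bump_rho hux
  have hrlt := h.fresh_rcv x u hux hxf
  have hmin_iff : (∀ j ∈ (s.bump (L.port x u)).ports,
      (s.bump (L.port x u)).rho (L.port x u) ≤ (s.bump (L.port x u)).rho j) ↔
      ∀ w ≠ u, G.Adj x w → g.rcv u x + 1 ≤ g.rcv w x := by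
    have hmem : ∀ j, j ∈ (s.bump (L.port x u)).ports ↔ ∃ w, G.Adj x w ∧ L.port x w = j :=
      fun j => L.mem_ports_iff (s := s.bump (L.port x u)) hs.deg
    constructor
    · intro hall w hwu hw
      have := hall _ ((hmem _).2 ⟨w, hw, rfl⟩)
      rw [hrho u hux, hrho w hw] at this
      simpa [Net.bump, update₂_apply, hwu] using this
    · intro hall j hj
      obtain ⟨w, hw, rfl⟩ := (hmem j).1 hj
      rw [hrho u hux, hrho w hw]
      by_cases hwu : w = u
      · rw [hwu]
      · simpa [Net.bump, update₂_apply, hwu] using hall w hwu hw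
  obtain ⟨w₀, hw₀, hle₀⟩ := h.counting_ex x hx
  have hcu := h.counting_le x u hux hx
  have hreact : s.receive (L.port x u) = (s.bump (L.port x u)).react (L.port x u) := rfl
  have hstage' : (s.bump (L.port x u)).stage = .counting := hstage
  have hsig : (s.bump (L.port x u)).sigma (L.port x u) = g.cnt x + 1 :=
    (hs.sigma u hux).trans (h.fresh_snt x u hux hxf)
  have hru : (s.bump (L.port x u)).rho (L.port x u) = g.rcv u x + 1 := by
    simp [hrho u hux, Net.bump, update₂_apply]
  have hlt_id := hs.count_lt hx
  rw [hs.count, hs.scaledId] at hlt_id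
  rw [hreact, NodeState.react, hstage', hsig, hru]
  rw [hru] at hmin_iff
  simp only [hmin_iff]
  split_ifs with hall htrig
  · have hcnt : g.rcv u x = g.cnt x := by
      refine le_antisymm ?_ hcu
      by_cases hwu : w₀ = u
      · exact hwu ▸ hle₀
      · have := hall w₀ hwu hw₀
        omega
    have h' := h.increment hN hux hlt hx hcnt (fun w hw hxw => hcnt ▸ hall w hw hxw)
      (fun hxr => by subst hxr; omega)
    have hcl' := h'.cnt_lt hN x
    simp only [Function.update_self] at hcl'
    unfold NodeState.increment
    dsimp only
    split_ifs with hid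
    · have hcid : g.cnt x + 1 = L.id x * N := by
        have h1 : s.count + 1 = s.scaledId := hid
        rwa [hs.count, hs.scaledId] at h1
      have hxr : x = r := by
        by_contra hxr
        have h1 : L.id r < L.id x :=
          (hmin x).lt_of_ne fun he => hxr (L.id_injective he).symm
        have h2 : (L.id r + 1) * N ≤ L.id x * N := Nat.mul_le_mul_right N h1
        rw [add_mul, one_mul] at h2
        omega
      subst hxr
      have h'' := h'.startLeader hx (by simpa using hcid)
      refine (nextPort_actsWell hN hG h'' (x := x) ?_ (by simp)).of_agreeAt ?_
      · have hports := fun i => L.mem_ports_iff (i := i) hs.deg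
        have hne : ∀ w, G.Adj x w → (g.bump u x).rcv w x ≠ L.id x * N + N + 2 := by
          intro w hw
          have := h.fresh_rcv x w hw hxf
          simp only [Net.bump, update₂_apply]
          split_ifs <;> omega
        have hpr := h.par_root
        obtain ⟨h1, h2, h3, h4, h5, h6, h7, h8, h9, h10, h11, h12⟩ := hs
        constructor
        case unexplored =>
          intro _ _ i
          refine (hports i).trans (exists_congr fun w => ?_)
          refine and_congr_right fun hw => ?_
          have := hne w hw
          simpa [hpr, Net.bump] using fun _ => this
        all_goals first
          | assumption
          | simp_all [StageMatches, NodeState.bump, NodeState.sendAll]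
      · intro v hv
        constructor <;> simp [update₂_apply, hv]
    · refine ⟨_, h', ?_, by simp [hx], ?_⟩
      · intro v hv
        constructor <;> simp [update₂_apply, hv]
      · have hidlt : s.count + 1 < s.scaledId := by
          have h1 : s.count + 1 ≠ s.scaledId := hid
          have := hs.count_lt hx
          omega
        obtain ⟨h1, h2, h3, h4, h5, h6, h7, h8, h9, h10, h11, h12⟩ := hs
        constructor <;> first
          | assumption
          | simp_all [StageMatches, NodeState.bump, NodeState.sendAll]
  · have hp := h.par_of_lt_snt hN hux hx (by omega)
    have hM := h.le_cnt_of_par hxf hp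
    have hdiv : g.cnt x / N = L.id r := by
      apply Nat.div_eq_of_lt_le
      · exact hM
      · have := hcl x
        rwa [add_mul, one_mul]
    have hxr : x ≠ r := fun hxr => by simp [hxr, h.par_root] at hp
    refine (tryJoin_actsWell hN hG (h.becomeNonLeader hx hp) (x := x) (u := u) (by simp) hux hlt
      ?_).of_agreeAt ?_
    · have hports := fun i => L.mem_ports_iff (i := i) hs.deg
      have hne : ∀ w, G.Adj x w → w ≠ u →
          (g.bump u x).rcv w x ≠ L.id r * N + N + 2 := by
        intro w hw hwu
        have := h.fresh_rcv x w hw hxf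
        simp only [Net.bump, update₂_apply, hwu, false_and, if_false]
        omega
      obtain ⟨h1, h2, h3, h4, h5, h6, h7, h8, h9, h10, h11, h12⟩ := hs
      constructor
      case unexplored =>
        intro _ _ i
        refine (Finset.mem_erase.trans (and_congr_right' (hports i))).trans ?_
        constructor
        · rintro ⟨hi, w, hw, rfl⟩
          have hwu : w ≠ u := fun hwu => hi (by rw [hwu])
          exact ⟨w, hw, rfl, by simpa [Net.bump, hp] using hwu.symm, hne w hw hwu⟩
        · rintro ⟨w, hw, rfl, hwp, -⟩
          refine ⟨fun hi => ?_, w, hw, rfl⟩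
          obtain rfl := (L.port_inj hw hux).1 hi
          exact hwp hp
      all_goals first
        | assumption
        | simp_all [StageMatches, NodeState.bump, Net.bump]
    · intro v hv
      constructor <;> simp [hv]
  · have hlt' : g.rcv u x + 1 < L.id r * N + N + 2 := by
      have := hcl x
      omega
    refine ⟨g.bump u x, h.receive hux hlt hlt' (fun _ => ?_) (by simp [hx]),
      fun v hv => g.agreeAt_bump hv, by simp [Net.bump, hx],
      hs.bump hux (by omega) fun _ => by omega⟩
    push Not at hall
    obtain ⟨w, hwu, hw, hle⟩ := hall
    by_cases hw₀u : w₀ = u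
    · subst hw₀u
      exact ⟨w, hwu, hw, by omega⟩
    · exact ⟨w₀, hw₀u, hw₀, hle₀⟩

/-- Every node reacts correctly to every pulse, and no pulse arrives at a finished node. -/
theorem receive_actsWell (hN : Fintype.card V ≤ N) (hG : G.IsEdgeConnected 2)
    (hmin : ∀ v, L.id r ≤ L.id v) (h : Inv G r (L.id r * N) N g) {u x : V} {s : NodeState}
    (hs : Represents L r N g x s) (hhold : g.phase x ≠ .hold) (hux : G.Adj x u)
    (hlt : g.rcv u x < g.snt u x) :
    g.phase x ≠ .finished ∧ ActsWell L r N g x (s.receive (L.port x u)) := by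
  have hsnt := h.snt_le hN hux.symm
  have hcl := h.cnt_lt hN
  have hrho := hs.bump_rho hux
  have hru : (s.bump (L.port x u)).rho (L.port x u) = g.rcv u x + 1 := by
    simp [hrho u hux, Net.bump, update₂_apply]
  have hreact : s.receive (L.port x u) = (s.bump (L.port x u)).react (L.port x u) := rfl
  cases hx : g.phase x with
  | counting => exact ⟨by simp, counting_actsWell hN hG hmin h hs hux hlt hx⟩
  | hold => exact absurd hx hhold
  | finished =>
    have := (h.finished x u hux hx).1
    omega
  | awaitExplore =>
    have hxf : g.Fresh x := Or.inr hx
    refine ⟨by simp, ?_⟩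
    have hstage : s.stage = .awaitExplore := by
      simpa [hx, StageMatches] using hs.stage
    rw [hreact, NodeState.react, show (s.bump (L.port x u)).stage = _ from hstage]
    refine tryJoin_actsWell hN hG h hx hux hlt (hs.bump hux (by omega) fun hp => ?_)
    have h1 := h.snt_eq_of_fresh hN hux hxf hp
    have h2 := hcl u
    omega
  | ready j =>
    refine ⟨by simp, ?_⟩
    have hstage : s.stage = .awaitReady (L.port x j) := by
      simpa [hx, StageMatches] using hs.stage
    rw [hreact, NodeState.react, show (s.bump (L.port x u)).stage = _ from hstage]
    obtain ⟨l, hl⟩ := h.stack_eq_cons (Or.inr ⟨j, hx⟩)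
    obtain ⟨hj, hpj, hle⟩ := h.ready x j hx
    have hpu : g.par x ≠ some u := fun hpu => by
      have := (h.active_par x u (by simp [hl]) hpu).1
      omega
    have hsl := h.snt_lt_of_head hN hl hux hpu (by simp [hx]) (by omega)
    have h' := (h.holdOfReady hx).receive hux hlt
      (show g.rcv u x + 1 < L.id r * N + N + 2 by omega) (by simp) (by simp)
    refine (tryExplore_actsWell hN hG h' (x := x) (j := j) ?_ (by simp) hj hpj ?_).of_agreeAt ?_
    · have hs' := hs.bump hux (by omega) fun _ => by omega
      obtain ⟨h1, h2, h3, h4, h5, h6, h7, h8, h9, h10, h11, h12⟩ := hs'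
      constructor <;> first | assumption | simp_all [StageMatches, Net.bump]
    · simp only [update₂_apply]
      split_ifs <;> omega
    · intro v hv
      constructor <;> simp [update₂_apply, hv]
  | done j =>
    refine ⟨by simp, ?_⟩
    have hstage : s.stage = .awaitDone (L.port x j) := by
      simpa [hx, StageMatches] using hs.stage
    have hxs : x ∈ g.stack := (h.mem_stack x).2 (by simp [Net.Fresh, hx])
    obtain ⟨hj, hpj, -⟩ := h.done x j hx
    have hpu : g.par x ≠ some u := fun hpu => by
      have := (h.active_par x u hxs hpu).1
      omega
    have hmem : L.port x u ∈ (s.bump (L.port x u)).unexplored :=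
      (hs.unexplored (by simp [hx]) (by simp [hx]) _).2 ⟨u, hux, rfl, hpu, by omega⟩
    have hT : (s.bump (L.port x u)).threshold = L.id r * N + N + 2 :=
      hs.threshold (by simp [hx])
    have herase : ∀ i, i ∈ s.unexplored.erase (L.port x u) ↔ ∃ w, G.Adj x w ∧ L.port x w = i ∧
        g.par x ≠ some w ∧ w ≠ u ∧ g.rcv w x ≠ L.id r * N + N + 2 := by
      intro i
      rw [Finset.mem_erase, hs.unexplored (by simp [hx]) (by simp [hx])]
      constructor
      · rintro ⟨hi, w, hw, rfl, hw'⟩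
        exact ⟨w, hw, rfl, hw'.1, fun hwu => hi (by rw [hwu]), hw'.2⟩
      · rintro ⟨w, hw, rfl, hw', hwu, hr⟩
        exact ⟨fun hi => hwu ((L.port_inj hw hux).1 hi), w, hw, rfl, hw', hr⟩
    have hun : g.rcv u x + 1 = L.id r * N + N + 2 → ∀ w,
        (w ≠ u ∧ g.rcv w x ≠ L.id r * N + N + 2) ↔
          (g.bump u x).rcv w x ≠ L.id r * N + N + 2 := by
      intro hfull w
      by_cases hwu : w = u
      · subst hwu
        simp [Net.bump, update₂_apply, hfull]
      · simp [Net.bump, update₂_apply, hwu]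
    rw [hreact, NodeState.react, show (s.bump (L.port x u)).stage = _ from hstage]
    simp only [hmem, true_and, hT, hru, L.port_inj hux hj]
    split_ifs with hfull huj
    · subst huj
      refine (nextPort_actsWell hN hG (h.returnFrom hN hx hlt hfull) ?_ (by simp)).of_agreeAt ?_
      · obtain ⟨h1, h2, h3, h4, h5, h6, h7, h8, h9, h10, h11, h12⟩ := hs
        constructor
        case unexplored =>
          simp only [hun hfull] at herase
          exact fun _ _ => herase
        all_goals first
          | assumption
          | simp_all [StageMatches, NodeState.bump]
      · intro v hv
        constructor <;> simp [update₂_apply, hv]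
    · refine ⟨_, h.reply hx huj hpu hlt (h.snt_le hN hux) hfull, ?_, by simp [hx], ?_⟩
      · intro v hv
        constructor <;> grind [update₂_apply]
      · have hsig := hs.sigma_sendNotification (by simp [hx]) hux (h.snt_le hN hux)
        obtain ⟨h1, h2, h3, h4, h5, h6, h7, h8, h9, h10, h11, h12⟩ := hs
        constructor
        case unexplored =>
          simp only [hun hfull] at herase
          exact fun _ _ => herase
        all_goals first
          | assumption
          | simp_all [StageMatches, NodeState.bump, NodeState.sendNotification]
    · refine ⟨g.bump u x, h.receive hux hlt (by omega) (by simp [hx]) (by simp [hx]),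
        fun v hv => g.agreeAt_bump hv, by simp [Net.bump, hx],
        hs.bump hux (by omega) fun _ => hfull⟩

end Reactions

/-! ### Executions -/

section Execution

variable {V : Type*} [Fintype V] [DecidableEq V] {G : SimpleGraph V} [DecidableRel G.Adj]
  {L : Labeling G} {r : V} {N : ℕ}

theorem Config.deliver_received (c : Config election G) (d : G.Dart) :
    (c.deliver L d).received = Function.update c.received d (c.received d + 1) := by
  unfold Config.deliver
  dsimp only
  split_ifs <;> rfl

theorem Config.deliver_state_of_ne (c : Config election G) {d : G.Dart} {v : V}
    (hv : v ≠ d.snd) : (c.deliver L d).state v = c.state v := by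
  unfold Config.deliver
  dsimp only
  split_ifs
  · rfl
  · exact Function.update_of_ne hv _ _

theorem Config.deliver_state_self {c : Config election G} {d : G.Dart} {s : NodeState}
    (hs : c.state d.snd = s) (hh : election.halted (c.state d.snd) ≠ true) :
    (c.deliver L d).state d.snd = s.receive (L.port d.snd d.fst) := by
  subst hs
  unfold Config.deliver
  dsimp only
  rw [if_neg hh]
  exact Function.update_self _ _ _

theorem Config.deliver_sent {c : Config election G} {d : G.Dart} {s : NodeState}
    (hs : c.state d.snd = s) (hh : election.halted (c.state d.snd) ≠ true) (e : G.Dart) :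
    (c.deliver L d).sent e = if e.fst = d.snd then
      c.sent e + ((s.receive (L.port d.snd d.fst)).sigma (L.port d.snd e.snd) -
        s.sigma (L.port d.snd e.snd)) else c.sent e := by
  subst hs
  unfold Config.deliver
  dsimp only
  rw [if_neg hh]
  rfl

theorem Config.deliver_state_of_halted (c : Config election G) (d : G.Dart) {v : V}
    (hv : election.halted (c.state v) = true) : (c.deliver L d).state v = c.state v := by
  by_cases hvd : v = d.snd
  · subst hvd
    unfold Config.deliver
    dsimp only
    rw [if_pos hv]
  · exact c.deliver_state_of_ne hvd

/-- The configuration `c` is described by a snapshot that satisfies the invariant. -/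
def Config.Valid (L : Labeling G) (r : V) (N : ℕ) (c : Config election G) : Prop :=
  ∃ g, Inv G r (L.id r * N) N g ∧ (∀ v, g.phase v ≠ .hold) ∧
    (∀ v, Represents L r N g v (c.state v)) ∧
    ∀ d, c.sent d = g.snt d.fst d.snd ∧ c.received d = g.rcv d.fst d.snd

theorem Represents.halted_iff {g : Net V} {v : V} {s : NodeState}
    (hs : Represents L r N g v s) (hv : g.phase v ≠ .hold) :
    election.halted s = true ↔ g.phase v = .finished := by
  have h := hs.stage
  change (match s.stage with | .finished => true | _ => false) = true ↔ _
  cases hp : g.phase v <;> simp_all [StageMatches]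

theorem Config.valid_initial [Nontrivial V] (hN : Fintype.card V ≤ N)
    (hG : G.IsEdgeConnected 2) : (Config.initial election L N).Valid L r N := by
  have hdeg : ∀ v, G.degree v ≠ 0 := fun v =>
    ((G.degree_pos_iff_exists_adj v).2 (exists_adj_of_isEdgeConnected_two hG v)).ne'
  refine ⟨Net.start, Inv.start hG, by simp [Net.start], fun v => ?_, fun d => ⟨rfl, rfl⟩⟩
  have hpos : 0 < L.id v * N := Nat.mul_pos (L.id_pos v)
    ((Fintype.card_pos_iff.2 ⟨v⟩).trans_le hN)
  constructor <;> simp [Config.initial, election, NodeState.start, Net.start, StageMatches, hdeg,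
    hpos]

/-- Deliveries preserve validity; the numbers of pulses sent and received on an edge agree with those
kept by its ends because no node is halted when a pulse arrives at it. -/
theorem Config.Valid.deliver (hN : Fintype.card V ≤ N) (hG : G.IsEdgeConnected 2)
    (hmin : ∀ v, L.id r ≤ L.id v) {c : Config election G} (hc : c.Valid L r N) {d : G.Dart}
    (hd : c.InTransit d) : (c.deliver L d).Valid L r N := by
  obtain ⟨g, h, hhold, hs, hdart⟩ := hc
  have hlt : g.rcv d.fst d.snd < g.snt d.fst d.snd := by
    rw [← (hdart d).1, ← (hdart d).2]
    exact hd
  obtain ⟨hfin, g', h', hagree, hhold', hs'⟩ := receive_actsWell hN hG hmin h (hs d.snd)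
    (hhold _) d.adj.symm hlt
  have hhalt : election.halted (c.state d.snd) ≠ true := fun hh =>
    hfin (((hs d.snd).halted_iff (hhold _)).1 hh)
  obtain ⟨s, hsd⟩ : ∃ s : NodeState, c.state d.snd = s := ⟨_, rfl⟩
  have hself := Config.deliver_state_self (L := L) hsd hhalt
  have hsent := Config.deliver_sent (L := L) hsd hhalt
  have hrep : Represents L r N g d.snd s := hsd ▸ hs d.snd
  have hrep' : Represents L r N g' d.snd (s.receive (L.port d.snd d.fst)) := hsd ▸ hs'
  refine ⟨g', h', fun v => ?_, fun v => ?_, fun e => ⟨?_, ?_⟩⟩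
  · by_cases hv : v = d.snd
    · exact hv ▸ hhold'
    · rw [(hagree v hv).phase]
      exact hhold v
  · by_cases hv : v = d.snd
    · rw [hv, hself]
      exact hrep'
    · rw [Config.deliver_state_of_ne _ hv]
      exact (hs v).congr (hagree v hv)
  · rw [hsent]
    by_cases he : e.fst = d.snd
    · have hadj : G.Adj d.snd e.snd := he ▸ e.adj
      have h1 := hrep.sigma e.snd hadj
      have h2 := hrep'.sigma e.snd hadj
      have h3 := s.sigma_le_receive (L.port d.snd d.fst) (L.port d.snd e.snd)
      have h4 := (hdart e).1
      rw [he] at h4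
      rw [if_pos he, he]
      omega
    · rw [if_neg he, (hdart e).1, (hagree e.fst he).snt]
  · rw [Config.deliver_received, Function.update_apply]
    by_cases he : e.snd = d.snd
    · have hadj : G.Adj d.snd e.fst := he ▸ e.adj.symm
      have h1 := hrep'.rho e.fst hadj
      simp only [NodeState.receive_rho, Function.update_apply, L.port_inj hadj d.adj.symm] at h1
      have h2 := hrep.rho e.fst hadj
      have h3 := hrep.rho d.fst d.adj.symm
      have h4 := (hdart e).2
      have h5 := (hdart d).2
      rw [he] at h4 ⊢
      by_cases hed : e = d
      · subst hed
        rw [if_pos rfl] at h1 ⊢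
        omega
      · have hne : e.fst ≠ d.fst := fun hf => hed (SimpleGraph.Dart.ext _ _ (Prod.ext hf he))
        rw [if_neg hne] at h1
        rw [if_neg hed]
        omega
    · have hed : e ≠ d := fun hed => he (by rw [hed])
      rw [if_neg hed, (hdart e).2, (hagree e.snd he).rcv]

theorem Config.Valid.received_le {c : Config election G} (hc : c.Valid L r N) (d : G.Dart) :
    c.received d ≤ c.sent d := by
  obtain ⟨g, h, -, -, hdart⟩ := hc
  rw [(hdart d).1, (hdart d).2]
  exact h.rcv_le _ _ d.adj

theorem Config.Valid.sent_le (hN : Fintype.card V ≤ N) {c : Config election G}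
    (hc : c.Valid L r N) (d : G.Dart) : c.sent d ≤ L.id r * N + N + 2 := by
  obtain ⟨g, h, -, -, hdart⟩ := hc
  rw [(hdart d).1]
  exact h.snt_le hN d.adj

theorem Config.Valid.sent_eq {c : Config election G} (hc : c.Valid L r N) {d : G.Dart}
    (hd : election.halted (c.state d.fst) = true) : c.sent d = L.id r * N + N + 2 := by
  obtain ⟨g, h, hhold, hs, hdart⟩ := hc
  rw [(hdart d).1]
  exact (h.finished _ _ d.adj (((hs _).halted_iff (hhold _)).1 hd)).2

theorem Config.Valid.received_eq {c : Config election G} (hc : c.Valid L r N) {d : G.Dart}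
    (hd : election.halted (c.state d.snd) = true) : c.received d = L.id r * N + N + 2 := by
  obtain ⟨g, h, hhold, hs, hdart⟩ := hc
  rw [(hdart d).2]
  exact (h.finished _ _ d.adj.symm (((hs _).halted_iff (hhold _)).1 hd)).1

theorem Config.Valid.output_eq {c : Config election G} (hc : c.Valid L r N) {v : V}
    (hv : election.halted (c.state v) = true) :
    election.output (c.state v) = some (if v = r then .leader else .nonLeader) := by
  obtain ⟨g, h, hhold, hs, -⟩ := hc
  have hp := ((hs v).halted_iff (hhold v)).1 hv
  exact (hs v).role (by simp [hp])

theorem Config.Valid.all_halted (hN : Fintype.card V ≤ N) (hG : G.IsEdgeConnected 2)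
    {c : Config election G} (hc : c.Valid L r N) (hr : election.halted (c.state r) = true) (v : V) :
    election.halted (c.state v) = true := by
  obtain ⟨g, h, hhold, hs, -⟩ := hc
  exact ((hs v).halted_iff (hhold v)).2
    (h.all_finished hN hG (((hs r).halted_iff (hhold r)).1 hr) v)

theorem Config.Valid.all_halted_of_quiescent (hN : Fintype.card V ≤ N)
    (hG : G.IsEdgeConnected 2) {c : Config election G} (hc : c.Valid L r N)
    (hq : ∀ d, ¬ c.InTransit d) (v : V) : election.halted (c.state v) = true := by
  have hle := hc.received_le
  obtain ⟨g, h, hhold, hs, hdart⟩ := hc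
  refine ((hs v).halted_iff (hhold v)).2
    (h.all_finished_of_quiescent hN hG (fun u w huw => ?_) hhold (fun hr => ?_) v)
  · have h1 := hdart ⟨(u, w), huw⟩
    rw [← h1.1, ← h1.2]
    exact le_antisymm (hle _) (not_lt.1 (hq _))
  · have h1 := (hs r).count_lt hr
    rwa [(hs r).count, (hs r).scaledId] at h1

variable {c : ℕ → Config election G}

theorem IsExecution.valid [Nontrivial V] (hc : IsExecution L N c) (hN : Fintype.card V ≤ N)
    (hG : G.IsEdgeConnected 2) (hmin : ∀ v, L.id r ≤ L.id v) (t : ℕ) : (c t).Valid L r N := by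
  induction t with
  | zero => exact hc.1 ▸ Config.valid_initial hN hG
  | succ t ih =>
    rcases hc.2 t with ⟨d, hd, he⟩ | ⟨-, he⟩
    · exact he ▸ ih.deliver hN hG hmin hd
    · exact he ▸ ih

/-- Every step delivers a pulse until none is in transit, and only boundedly many pulses are ever
sent. -/
theorem IsExecution.exists_quiescent (hc : IsExecution L N c) {B : ℕ}
    (hB : ∀ t d, (c t).received d ≤ B) : ∃ t, ∀ d, ¬ (c t).InTransit d := by
  by_contra! hcon
  have hsum : ∀ t, t ≤ ∑ d, (c t).received d := by
    intro t
    induction t with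
    | zero => exact Nat.zero_le _
    | succ t ih =>
      rcases hc.2 t with ⟨d, hd, he⟩ | ⟨hq, -⟩
      · rw [he, Config.deliver_received, Finset.sum_update_of_mem (Finset.mem_univ d)]
        rw [← Finset.add_sum_erase _ _ (Finset.mem_univ d), Finset.erase_eq] at ih
        omega
      · obtain ⟨d, hd⟩ := hcon t
        exact absurd hd (hq d)
  have h1 := hsum (Fintype.card G.Dart * B + 1)
  have h2 := Finset.sum_le_card_nsmul Finset.univ _ B
    fun d _ => hB (Fintype.card G.Dart * B + 1) d
  rw [smul_eq_mul, Finset.card_univ] at h2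
  omega

theorem IsExecution.halted_mono (hc : IsExecution L N c) {v : V} {s t : ℕ} (hst : s ≤ t)
    (hs : election.halted ((c s).state v) = true) : election.halted ((c t).state v) = true := by
  induction t, hst using Nat.le_induction with
  | base => exact hs
  | succ t _ ih =>
    rcases hc.2 t with ⟨d, -, he⟩ | ⟨-, he⟩
    · rw [he, Config.deliver_state_of_halted _ _ ih]
      exact ih
    · rwa [he]

/-- Two nodes never terminate in the same step. -/
theorem IsExecution.eq_of_halts (hc : IsExecution L N c) {v w : V} {t : ℕ}
    (hv : election.halted ((c t).state v) = false)
    (hv' : election.halted ((c (t + 1)).state v) = true)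
    (hw : election.halted ((c t).state w) = false)
    (hw' : election.halted ((c (t + 1)).state w) = true) : v = w := by
  rcases hc.2 t with ⟨d, -, he⟩ | ⟨-, he⟩
  · have key : ∀ x, election.halted ((c t).state x) = false →
        election.halted ((c (t + 1)).state x) = true → x = d.snd := by
      intro x hx hx'
      by_contra hne
      rw [he, Config.deliver_state_of_ne _ hne, hx] at hx'
      exact Bool.false_ne_true hx'
    rw [key v hv hv', key w hw hw']
  · rw [he, hv] at hv'
    exact absurd hv' Bool.false_ne_true

end Execution

theorem IsExecution.correct_of_subsingleton {V : Type*} [Fintype V] [DecidableEq V]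
    [Subsingleton V] {G : SimpleGraph V} [DecidableRel G.Adj] {L : Labeling G} {N : ℕ}
    {c : ℕ → Config election G} (hc : IsExecution L N c) (r : V) (t : ℕ) :
    election.halted ((c t).state r) = true ∧ election.output ((c t).state r) = some .leader := by
  have hdart : ∀ d : G.Dart, False := fun d => d.adj.ne (Subsingleton.elim _ _)
  have hconst : c t = c 0 := by
    induction t with
    | zero => rfl
    | succ t ih =>
      rcases hc.2 t with ⟨d, -⟩ | ⟨-, he⟩
      · exact (hdart d).elim
      · exact he.trans ih
  rw [hconst, hc.1]
  simp [Config.initial, election, NodeState.start]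

end ContentOblivious

theorem theorem1 :
    ∃ C : ℕ, ∀ (V : Type*) [Fintype V] [DecidableEq V] (G : SimpleGraph V) [DecidableRel G.Adj]
      (L : ContentOblivious.Labeling G) (N : ℕ) (r : V)
      (c : ℕ → ContentOblivious.Config ContentOblivious.election G),
      G.IsEdgeConnected 2 → Fintype.card V ≤ N → (∀ v, L.id r ≤ L.id v) →
      ContentOblivious.IsExecution L N c →
      ∃ τ : V → ℕ,
        -- every node eventually terminates quiescently, at time `τ v`
        (∀ v, ContentOblivious.QuiescentlyTerminatesAt c v (τ v)) ∧
        -- the final outputs: `r` is the leader, every other node is a non-leader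
        (∀ t, τ r ≤ t →
          ContentOblivious.election.output ((c t).state r) = some .leader) ∧
        (∀ v, v ≠ r → ∀ t, τ v ≤ t →
          ContentOblivious.election.output ((c t).state v) = some .nonLeader) ∧
        -- the leader is the last node to terminate
        (∀ v, v ≠ r → τ v < τ r) ∧
        -- the total number of pulses is `O(m * N * ID_min)`
        (∀ t, ∑ d, (c t).sent d ≤ C * (G.edgeFinset.card * N * L.id r)) ∧
        -- in the end each directed edge has carried exactly `ID_min * N + N + 2` pulses
        (∀ t, τ r ≤ t → ∀ d,
          (c t).sent d = L.id r * N + N + 2 ∧ (c t).received d = L.id r * N + N + 2) := by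
  -- there are two directed edges per edge, and `ID * N + N + 2 ≤ 4 * (N * ID)` for positive `N`, `ID`
  refine ⟨8, ?_⟩
  intro V _ _ G _ L N r c hG hN hmin hc
  rcases subsingleton_or_nontrivial V with hV | hV
  · have hr := hc.correct_of_subsingleton
    have hdart : ∀ d : G.Dart, False := fun d => d.adj.ne (Subsingleton.elim _ _)
    refine ⟨fun _ => 0, fun v => ⟨⟨(hr v 0).1, fun s hs => absurd hs (Nat.not_lt_zero s)⟩,
      fun s _ d => (hdart d).elim⟩, fun t _ => (hr r t).2,
      fun v hv => absurd (Subsingleton.elim v r) hv, fun v hv => absurd (Subsingleton.elim v r) hv,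
      fun t => ?_, fun t _ d => (hdart d).elim⟩
    rw [Finset.sum_eq_zero fun d _ => (hdart d).elim]
    exact Nat.zero_le _
  · have hvalid := hc.valid hN hG hmin
    obtain ⟨t₀, ht₀⟩ := hc.exists_quiescent
      fun t d => ((hvalid t).received_le d).trans ((hvalid t).sent_le hN d)
    have hex : ∀ v, ∃ t, ContentOblivious.election.halted ((c t).state v) = true := fun v =>
      ⟨t₀, (hvalid t₀).all_halted_of_quiescent hN hG ht₀ v⟩
    obtain ⟨τ, hτ, hτ'⟩ : ∃ τ : V → ℕ,
        (∀ v t, τ v ≤ t → ContentOblivious.election.halted ((c t).state v) = true) ∧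
        ∀ v, ∀ t < τ v, ContentOblivious.election.halted ((c t).state v) = false :=
      ⟨fun v => Nat.find (hex v), fun v t ht => hc.halted_mono ht (Nat.find_spec (hex v)),
        fun v t ht => Bool.eq_false_iff.2 (Nat.find_min (hex v) ht)⟩
    refine ⟨τ, fun v => ⟨⟨hτ v _ le_rfl, hτ' v⟩, ?_⟩, ?_, ?_, ?_, ?_, ?_⟩
    · rintro s hs d rfl
      rw [(hvalid s).received_eq (hτ _ s hs), (hvalid _).received_eq (hτ _ _ le_rfl)]
    · intro t ht
      rw [(hvalid t).output_eq (hτ r t ht), if_pos rfl]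
    · intro v hv t ht
      rw [(hvalid t).output_eq (hτ v t ht), if_neg hv]
    · intro v hv
      have hle : τ v ≤ τ r := by
        by_contra! hlt
        have := (hvalid _).all_halted hN hG (hτ r _ le_rfl) v
        rw [hτ' v _ hlt] at this
        exact Bool.false_ne_true this
      refine lt_of_le_of_ne hle fun heq => ?_
      -- `r` has a neighbour, so it is still counting at time `0`
      have hpos : τ r ≠ 0 := by
        intro h0
        have hhalt := hτ r 0 h0.le
        have hdeg : 0 < G.degree r :=
          (G.degree_pos_iff_exists_adj r).2 (ContentOblivious.exists_adj_of_isEdgeConnected_two hG r)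
        rw [hc.1] at hhalt
        simp [ContentOblivious.Config.initial, ContentOblivious.election,
          ContentOblivious.NodeState.start, hdeg.ne'] at hhalt
      obtain ⟨t, ht⟩ := Nat.exists_eq_succ_of_ne_zero hpos
      exact hv (hc.eq_of_halts (t := t) (hτ' v t (by omega)) (hτ v _ (by omega))
        (hτ' r t (by omega)) (hτ r _ (by omega)))
    · intro t
      have hNpos : 0 < N := (Fintype.card_pos_iff.2 ⟨r⟩).trans_le hN
      have hid := L.id_pos r
      have h1 := Finset.sum_le_card_nsmul Finset.univ _ _ fun d _ => (hvalid t).sent_le hN d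
      rw [smul_eq_mul, Finset.card_univ, G.dart_card_eq_twice_card_edges] at h1
      have h2 : L.id r * N + N + 2 ≤ 4 * (N * L.id r) := by nlinarith
      calc _ ≤ _ := h1
        _ ≤ 2 * G.edgeFinset.card * (4 * (N * L.id r)) := Nat.mul_le_mul_left _ h2
        _ = _ := by ring
    · intro t ht d
      have hall := (hvalid t).all_halted hN hG (hτ r t ht)
      exact ⟨(hvalid t).sent_eq (hall _), (hvalid t).received_eq (hall _)⟩
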